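/- Let $K$ be a field and let $G$ be a finite connected simple graph with vertex set $[n]=\{1,\dots,n\}$. Let $J_G\subseteq S=K[x_1,\dots,x_n,y_1,\dots,y_n]$ be its binomial edge ideal, generated by the binomials $x_iy_j-x_jy_i$ with $i<j$ and $\{i,j\}\in E(G)$; it is called unmixed if all associated primes of $S/J_G$ have the same height. Suppose that $G$ is a generalized block graph, i.e. $G$ is chordal and whenever three distinct maximal cliques $F_1,F_2,F_3$ of $G$ satisfy $F_1\cap F_2\cap F_3\neq\emptyset$, then $F_1\cap F_2=F_1\cap F_3=F_2\cap F_3$ (a clique is identified with its vertex set). A cut set of $G$ is a set of vertices whose deletion increases the number of connected components, and a minimal cut set is a cut set that is minimal under inclusion. A minimal cut set $A$ is called a $t$-minimal cut set if there are $t$ distinct maximal cliques $F_1,\dots,F_t$ of $G$ with $\bigcap_{j=1}^t F_j=A$ such that every other maximal clique of $G$ is disjoint from $A$. Then $J_G$ is unmixed if and only if the following two conditions hold: (a) for every $t$ and every $t$-minimal cut set $A$ of $G$, $|A|=t-1$; (b) whenever $A_1,\dots,A_s$ are minimal cut sets of $G$ whose union $A_1\cup\dots\cup A_s$ is a maximal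 clique of $G$, then $|A_i|=1$ for some $i\in\{1,\dots,s\}$. -/

import Mathlib

namespace GenBlock

/-- A maximal clique of `G`, that is, a facet of the clique complex of `G`. -/
def IsMaxClique {V : Type*} (G : SimpleGraph V) (F : Finset V) : Prop :=
  Maximal (fun s : Finset V => G.IsClique (s : Set V)) F

/-- Every cycle of length at least `4` has a chord. -/
def IsChordal {V : Type*} (G : SimpleGraph V) : Prop :=
  ∀ (v : V) (c : G.Walk v v), c.IsCycle → 4 ≤ c.length →
    ∃ a ∈ c.support, ∃ b ∈ c.support, G.Adj a b ∧ s(a, b) ∉ c.edges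

/-- A chordal graph in which any three (distinct) maximal cliques with a common vertex have
equal pairwise intersections. Connectedness is assumed separately. -/
def IsGeneralizedBlockGraph {V : Type*} [DecidableEq V] (G : SimpleGraph V) : Prop :=
  IsChordal G ∧
    ∀ F₁ F₂ F₃ : Finset V, IsMaxClique G F₁ → IsMaxClique G F₂ → IsMaxClique G F₃ →
      F₁ ≠ F₂ → F₁ ≠ F₃ → F₂ ≠ F₃ → (F₁ ∩ F₂ ∩ F₃).Nonempty →
        F₁ ∩ F₂ = F₁ ∩ F₃ ∧ F₁ ∩ F₃ = F₂ ∩ F₃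

/-- A set of vertices whose deletion increases the number of connected components. -/
def IsCutSet {V : Type*} (G : SimpleGraph V) (A : Finset V) : Prop :=
  Nat.card G.ConnectedComponent < Nat.card (G.induce ((A : Set V)ᶜ)).ConnectedComponent

/-- A cut set that is minimal under inclusion. -/
def IsMinimalCutSet {V : Type*} (G : SimpleGraph V) (A : Finset V) : Prop :=
  Minimal (IsCutSet G) A

/-- A minimal cut set `A` that is the intersection of `t` maximal cliques, all other maximal
cliques being disjoint from `A`. -/
def IsTMinimalCutSet {V : Type*} [Fintype V] [DecidableEq V] (G : SimpleGraph V) (t : ℕ)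
    (A : Finset V) : Prop :=
  IsMinimalCutSet G A ∧
    ∃ 𝓕 : Finset (Finset V), 𝓕.card = t ∧ (∀ F ∈ 𝓕, IsMaxClique G F) ∧ 𝓕.inf id = A ∧
      ∀ F : Finset V, IsMaxClique G F → F ∉ 𝓕 → Disjoint F A

/-- The binomial edge ideal, generated by `x_i y_j - x_j y_i` for the edges `{i, j}`, in the
polynomial ring with variables `x_i = X (Sum.inl i)` and `y_i = X (Sum.inr i)`. Both
orientations of an edge are used; they give generators that differ by a sign. -/
noncomputable def binomialEdgeIdeal (K : Type*) [Field K] {V : Type*} (G : SimpleGraph V) :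
    Ideal (MvPolynomial (V ⊕ V) K) :=
  Ideal.span {f | ∃ i j : V, G.Adj i j ∧
    f = MvPolynomial.X (Sum.inl i) * MvPolynomial.X (Sum.inr j) -
      MvPolynomial.X (Sum.inl j) * MvPolynomial.X (Sum.inr i)}

/-- An ideal `I` is unmixed if all associated primes of `R / I` have the same height, the height
of `I`. -/
def IsUnmixed {R : Type*} [CommRing R] (I : Ideal R) : Prop :=
  ∀ P ∈ associatedPrimes R (R ⧸ I), P.height = I.height

end GenBlock

/-! For `S ⊆ V` let P_S be generated by the variables at `S` and the minors of all pairs lying in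
one component of G − S, and let c(S) be the number of these components. Each P_S is prime of height
n + |S| − c(S), and J_G is the intersection of all P_S (`relIdeal_eq_iInf`). Its associated primes
are exactly the P_S for which every vertex of `S` has neighbours in two components of G − S
(`HasCutProperty`). Since `S = ∅` qualifies, J_G is unmixed iff c(S) = |S| + 1 for all such `S`
(`isUnmixed_relIdeal_iff`).

The rest is counting. The nonempty intersections of two distinct maximal cliques ("junctions") are
pairwise disjoint, and chordality makes each of them separate all the cliques around it
(`IsJunction.no_walk`). Hence they are the minimal cut sets, and t_A is the number of maximal
cliques over A. For a union S of junctions A, c(S) + k(S) = 1 + Σ (t_A − 1), where k(S) counts the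
maximal cliques inside S (`numComp_sup`).

Applying the unmixedness criterion to a single junction gives (a). Under (a) the right-hand side is
|S| + 1, and every S with the cut property is a union of junctions, so what remains is k(S) = 0 for
these S. A maximal clique F covered by junctions of size at least 2 has the cut property itself,
because each junction lies in two further cliques. A one-point junction in F lies in only one
further clique, so no S ⊇ F has the cut property. This is (b). -/

namespace GenBlock

open MvPolynomial

/-! ### Decomposition of the ideal as an intersection over vertex sets -/

section RelIdeal

variable (K : Type*) [Field K] {V : Type*}

/-- The `2 × 2` minor of the generic `2 × V` matrix with columns `i` and `j`. -/
noncomputable def minor (i j : V) : MvPolynomial (V ⊕ V) K :=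
  X (Sum.inl i) * X (Sum.inr j) - X (Sum.inl j) * X (Sum.inr i)

/-- The ideal generated by both variables at each vertex of `T` and by the minors of the pairs
related by `r`. -/
noncomputable def relIdeal (r : V → V → Prop) (T : Finset V) : Ideal (MvPolynomial (V ⊕ V) K) :=
  Ideal.span ({f | ∃ v ∈ T, f = X (Sum.inl v) ∨ f = X (Sum.inr v)} ∪
    {f | ∃ i j, r i j ∧ f = minor K i j})

variable {K}

theorem relIdeal_le_iff {r : V → V → Prop} {T : Finset V} {I : Ideal (MvPolynomial (V ⊕ V) K)} :
    relIdeal K r T ≤ I ↔ (∀ v ∈ T, X (Sum.inl v) ∈ I ∧ X (Sum.inr v) ∈ I) ∧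
      ∀ i j, r i j → minor K i j ∈ I := by
  rw [relIdeal, Ideal.span_le]
  constructor
  · intro h
    exact ⟨fun v hv => ⟨h (Or.inl ⟨v, hv, Or.inl rfl⟩), h (Or.inl ⟨v, hv, Or.inr rfl⟩)⟩,
      fun i j hij => h (Or.inr ⟨i, j, hij, rfl⟩)⟩
  · rintro ⟨h1, h2⟩ f (⟨v, hv, rfl | rfl⟩ | ⟨i, j, hij, rfl⟩)
    exacts [(h1 v hv).1, (h1 v hv).2, h2 i j hij]

theorem X_inl_mem_relIdeal {r : V → V → Prop} {T : Finset V} {v : V} (hv : v ∈ T) :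
    X (Sum.inl v) ∈ relIdeal K r T := ((relIdeal_le_iff.1 le_rfl).1 v hv).1

theorem X_inr_mem_relIdeal {r : V → V → Prop} {T : Finset V} {v : V} (hv : v ∈ T) :
    X (Sum.inr v) ∈ relIdeal K r T := ((relIdeal_le_iff.1 le_rfl).1 v hv).2

theorem minor_mem_relIdeal {r : V → V → Prop} {T : Finset V} {i j : V} (h : r i j) :
    minor K i j ∈ relIdeal K r T := (relIdeal_le_iff.1 le_rfl).2 i j h

theorem minor_mem_of_left {r : V → V → Prop} {T : Finset V} {i : V} (j : V) (h : i ∈ T) :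
    minor K i j ∈ relIdeal K r T :=
  sub_mem (Ideal.mul_mem_right _ _ (X_inl_mem_relIdeal h))
    (Ideal.mul_mem_left _ _ (X_inr_mem_relIdeal h))

theorem minor_mem_of_right {r : V → V → Prop} {T : Finset V} (i : V) {j : V} (h : j ∈ T) :
    minor K i j ∈ relIdeal K r T :=
  sub_mem (Ideal.mul_mem_left _ _ (X_inr_mem_relIdeal h))
    (Ideal.mul_mem_right _ _ (X_inl_mem_relIdeal h))

@[simp] theorem minor_self (i : V) : minor K i i = 0 := sub_self _

theorem relIdeal_mono {r r' : V → V → Prop} {T T' : Finset V} (hT : T ⊆ T')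
    (h : ∀ i j, i ∉ T' → j ∉ T' → r i j → i = j ∨ r' i j) : relIdeal K r T ≤ relIdeal K r' T' := by
  refine relIdeal_le_iff.2 ⟨fun v hv => ⟨X_inl_mem_relIdeal (hT hv), X_inr_mem_relIdeal (hT hv)⟩,
    fun i j hij => ?_⟩
  by_cases hi : i ∈ T'
  · exact minor_mem_of_left j hi
  by_cases hj : j ∈ T'
  · exact minor_mem_of_right i hj
  rcases h i j hi hj hij with rfl | h
  · simp
  · exact minor_mem_relIdeal h

theorem eval_eq_zero_of_mem_relIdeal {r : V → V → Prop} {T : Finset V} {p q : V → K}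
    (hp : ∀ v ∈ T, p v = 0) (hq : ∀ v ∈ T, q v = 0) (h : ∀ i j, r i j → p i * q j = p j * q i)
    {f : MvPolynomial (V ⊕ V) K} (hf : f ∈ relIdeal K r T) : eval (Sum.elim p q) f = 0 := by
  have : relIdeal K r T ≤ RingHom.ker (eval (Sum.elim p q)) := by
    refine relIdeal_le_iff.2 ⟨fun v hv => ⟨?_, ?_⟩, fun i j hij => ?_⟩
    · simp [RingHom.mem_ker, hp v hv]
    · simp [RingHom.mem_ker, hq v hv]
    · simp [RingHom.mem_ker, minor, h i j hij]
  exact this hf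

theorem X_inl_notMem_relIdeal (r : V → V → Prop) {T : Finset V} {v : V} (hv : v ∉ T) :
    X (Sum.inl v) ∉ relIdeal K r T := by
  classical
  intro h
  have := eval_eq_zero_of_mem_relIdeal (p := fun i => if i ∈ T then 0 else 1)
    (q := fun i => if i ∈ T then 0 else 1) (by simp +contextual) (by simp +contextual)
    (fun i j _ => mul_comm _ _) h
  simp [hv] at this

theorem X_inr_notMem_relIdeal (r : V → V → Prop) {T : Finset V} {v : V} (hv : v ∉ T) :
    X (Sum.inr v) ∉ relIdeal K r T := by
  classical
  intro h
  have := eval_eq_zero_of_mem_relIdeal (p := fun i => if i ∈ T then 0 else 1)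
    (q := fun i => if i ∈ T then 0 else 1) (by simp +contextual) (by simp +contextual)
    (fun i j _ => mul_comm _ _) h
  simp [hv] at this

/-- Evaluate at the matrix with columns (1, 0) on the class of `i`, (0, 1) on the other classes and
0 on `T`: the ideal vanishes there, but the minor does not unless `j` is in the class of `i`. -/
theorem rel_of_minor_mem_relIdeal {r : V → V → Prop} (hr : Equivalence r) {T : Finset V} {i j : V}
    (hi : i ∉ T) (hj : j ∉ T) (h : minor K i j ∈ relIdeal K r T) : r i j := by
  classical
  by_contra hij
  have := eval_eq_zero_of_mem_relIdeal (p := fun k => if k ∉ T ∧ r i k then 1 else 0)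
    (q := fun k => if k ∉ T ∧ ¬ r i k then 1 else 0) (by simp +contextual) (by simp +contextual)
    (fun a b hab => by
      have : r i a ↔ r i b := ⟨fun h => hr.trans h hab, fun h => hr.trans h (hr.symm hab)⟩
      by_cases h : r i b <;> simp [this, h]) h
  simp [minor, hi, hj, hij, hr.refl i] at this

theorem algHom_sub_mem {σ : Type*} {I : Ideal (MvPolynomial σ K)}
    {φ : MvPolynomial σ K →ₐ[K] MvPolynomial σ K} (h : ∀ s, X s - φ (X s) ∈ I)
    (p : MvPolynomial σ K) : p - φ p ∈ I := by
  have : Ideal.Quotient.mkₐ K I = (Ideal.Quotient.mkₐ K I).comp φ := by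
    refine MvPolynomial.algHom_ext fun s => ?_
    simpa using Ideal.Quotient.eq.2 (h s)
  exact Ideal.Quotient.eq.1 (DFunLike.congr_fun this p)

/-- The relation obtained from `r` by completing the neighbourhood of `v`. -/
def completeAt (r : V → V → Prop) (v a b : V) : Prop := r a b ∨ (r v a ∧ r v b)

/-- Expanding a 3 × 3 determinant with a repeated row writes `x_v [a b]` as `x_a [v b] - x_b [v a]`,
and likewise for `y_v`. -/
theorem X_mul_mem_relIdeal {r : V → V → Prop} {T : Finset V} {v : V}
    {f : MvPolynomial (V ⊕ V) K} (hf : f ∈ relIdeal K (completeAt r v) T) :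
    X (Sum.inl v) * f ∈ relIdeal K r T ∧ X (Sum.inr v) * f ∈ relIdeal K r T := by
  induction hf using Submodule.span_induction with
  | mem f hf =>
    rcases hf with ⟨w, hw, rfl | rfl⟩ | ⟨a, b, h | ⟨ha, hb⟩, rfl⟩
    · exact ⟨Ideal.mul_mem_left _ _ (X_inl_mem_relIdeal hw),
        Ideal.mul_mem_left _ _ (X_inl_mem_relIdeal hw)⟩
    · exact ⟨Ideal.mul_mem_left _ _ (X_inr_mem_relIdeal hw),
        Ideal.mul_mem_left _ _ (X_inr_mem_relIdeal hw)⟩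
    · exact ⟨Ideal.mul_mem_left _ _ (minor_mem_relIdeal h),
        Ideal.mul_mem_left _ _ (minor_mem_relIdeal h)⟩
    · have h1 : X (Sum.inl v) * minor K a b =
          X (Sum.inl a) * minor K v b - X (Sum.inl b) * minor K v a := by
        simp only [minor]; ring
      have h2 : X (Sum.inr v) * minor K a b =
          X (Sum.inr a) * minor K v b - X (Sum.inr b) * minor K v a := by
        simp only [minor]; ring
      rw [h1, h2]
      exact ⟨sub_mem (Ideal.mul_mem_left _ _ (minor_mem_relIdeal hb))
        (Ideal.mul_mem_left _ _ (minor_mem_relIdeal ha)),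
        sub_mem (Ideal.mul_mem_left _ _ (minor_mem_relIdeal hb))
        (Ideal.mul_mem_left _ _ (minor_mem_relIdeal ha))⟩
  | zero => simp
  | add f g _ _ hf hg =>
    rw [mul_add, mul_add]
    exact ⟨add_mem hf.1 hg.1, add_mem hf.2 hg.2⟩
  | smul a f _ hf =>
    rw [smul_eq_mul, mul_left_comm, mul_left_comm (X (Sum.inr v))]
    exact ⟨Ideal.mul_mem_left _ _ hf.1, Ideal.mul_mem_left _ _ hf.2⟩

section Kill

variable [DecidableEq V]

/-- The retraction that sends the variables at the vertices of `T` to zero. -/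
noncomputable def kill (T : Finset V) : MvPolynomial (V ⊕ V) K →ₐ[K] MvPolynomial (V ⊕ V) K :=
  aeval (Sum.elim (fun v => if v ∈ T then 0 else X (Sum.inl v))
    fun v => if v ∈ T then 0 else X (Sum.inr v))

@[simp] theorem kill_X_inl (T : Finset V) (v : V) :
    kill T (X (Sum.inl v) : MvPolynomial (V ⊕ V) K) = if v ∈ T then 0 else X (Sum.inl v) := by
  simp [kill]

@[simp] theorem kill_X_inr (T : Finset V) (v : V) :
    kill T (X (Sum.inr v) : MvPolynomial (V ⊕ V) K) = if v ∈ T then 0 else X (Sum.inr v) := by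
  simp [kill]

theorem kill_minor (T : Finset V) (i j : V) :
    kill T (minor K i j) = if i ∈ T ∨ j ∈ T then 0 else minor K i j := by
  by_cases hi : i ∈ T <;> by_cases hj : j ∈ T <;> simp [minor, hi, hj]

theorem sub_kill_mem {T : Finset V} {I : Ideal (MvPolynomial (V ⊕ V) K)}
    (h : ∀ v ∈ T, X (Sum.inl v) ∈ I ∧ X (Sum.inr v) ∈ I) (p : MvPolynomial (V ⊕ V) K) :
    p - kill T p ∈ I := by
  refine algHom_sub_mem (fun s => ?_) p
  rcases s with v | v <;> by_cases hv : v ∈ T <;> simp [hv, h]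

theorem kill_mem_relIdeal {r : V → V → Prop} {T T' : Finset V} {p : MvPolynomial (V ⊕ V) K}
    (hp : p ∈ relIdeal K r (T' ∪ T)) : kill T' p ∈ relIdeal K r T := by
  have : relIdeal K r (T' ∪ T) ≤ (relIdeal K r T).comap (kill T').toRingHom := by
    refine relIdeal_le_iff.2 ⟨fun v hv => ?_, fun i j hij => ?_⟩
    · by_cases h : v ∈ T'
      · simp [h]
      · have : v ∈ T := by simpa [h] using hv
        simp [h, X_inl_mem_relIdeal this, X_inr_mem_relIdeal this]
    · simp only [AlgHom.toRingHom_eq_coe, Ideal.mem_comap, RingHom.coe_coe, kill_minor]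
      split_ifs
      · simp
      · exact minor_mem_relIdeal hij
  exact this hp

theorem sub_kill_singleton_mem_relIdeal {r : V → V → Prop} {T : Finset V} {v : V}
    {f : MvPolynomial (V ⊕ V) K} (hf : f ∈ relIdeal K (completeAt r v) T) :
    f - kill {v} f ∈ relIdeal K r T := by
  induction hf using Submodule.span_induction with
  | mem f hf =>
    rcases hf with ⟨w, hw, rfl | rfl⟩ | ⟨a, b, h | ⟨ha, hb⟩, rfl⟩
    · by_cases h : w = v <;> simp [h]
      exact h ▸ X_inl_mem_relIdeal hw
    · by_cases h : w = v <;> simp [h]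
      exact h ▸ X_inr_mem_relIdeal hw
    · rw [kill_minor]
      split_ifs
      · simpa using minor_mem_relIdeal h
      · simp
    · rw [kill_minor]
      split_ifs with h
      · rw [sub_zero]
        simp only [Finset.mem_singleton] at h
        rcases h with rfl | rfl
        · exact minor_mem_relIdeal hb
        · rw [show minor K a b = - minor K b a by simp [minor]]
          exact neg_mem (minor_mem_relIdeal ha)
      · simp
  | zero => simp
  | add f g _ _ hf hg => simpa [add_sub_add_comm] using add_mem hf hg
  | smul a f hmem hf =>
    -- The first summand is handled by `X_mul_mem_relIdeal`, because `a - kill {v} a` lies in the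
    -- ideal of the two variables at `v`.
    have : a • f - kill {v} (a • f) = (a - kill {v} a) * f + kill {v} a * (f - kill {v} f) := by
      simp only [smul_eq_mul, map_mul]; ring
    rw [this]
    refine add_mem ?_ (Ideal.mul_mem_left _ _ hf)
    have h : a - kill {v} a ∈ (relIdeal K r T).colon {f} := by
      refine sub_kill_mem (T := {v}) (fun w hw => ?_) a
      rw [Finset.mem_singleton.1 hw]
      simpa [Submodule.mem_colon_singleton] using X_mul_mem_relIdeal hmem
    simpa [Submodule.mem_colon_singleton] using h

/-- Split `f` as `(f - kill {v} f) + kill {v} f`; each of the two memberships takes care of one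
summand. This is the inductive step of the decomposition. -/
theorem relIdeal_completeAt_inf_le (r : V → V → Prop) (T : Finset V) (v : V) :
    relIdeal K (completeAt r v) T ⊓ relIdeal K r (insert v T) ≤ relIdeal K r T := by
  rintro f ⟨h1, h2⟩
  rw [← sub_add_cancel f (kill {v} f)]
  exact add_mem (sub_kill_singleton_mem_relIdeal h1) (kill_mem_relIdeal h2)

end Kill

/-- Connectedness by `r` outside `S`. -/
def Conn (r : V → V → Prop) (S : Finset V) : V → V → Prop :=
  Relation.EqvGen fun a b => r a b ∧ a ∉ S ∧ b ∉ S

theorem conn_equivalence (r : V → V → Prop) (S : Finset V) : Equivalence (Conn r S) :=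
  Relation.EqvGen.is_equivalence _

theorem Conn.mono {r r' : V → V → Prop} {S : Finset V} (h : ∀ a b, r a b → r' a b) {a b : V}
    (hab : Conn r S a b) : Conn r' S a b :=
  Relation.EqvGen.mono (fun _ _ hab => ⟨h _ _ hab.1, hab.2⟩) _ _ hab

theorem relIdeal_le_relIdeal_conn (r : V → V → Prop) {T S : Finset V} (h : T ⊆ S) :
    relIdeal K r T ≤ relIdeal K (Conn r S) S :=
  relIdeal_mono h fun _ _ hi hj hij => Or.inr (.rel _ _ ⟨hij, hi, hj⟩)

theorem iInf_relIdeal_conn_le [Fintype V] {r : V → V → Prop} (hr : ∀ a b, r a b → r b a)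
    (T : Finset V) : ⨅ S, ⨅ (_ : T ⊆ S), relIdeal K (Conn r S) S ≤ relIdeal K r T := by
  classical
  -- Completing at `v` lowers the number of unrelated pairs; moving `v` into `T` lowers the size of
  -- the complement.
  induction hn : (Finset.univ.filter fun p : V × V => ¬ r p.1 p.2).card + (Tᶜ).card
    using Nat.strong_induction_on generalizing r T with
  | _ n ih =>
  by_cases hs : ∃ v ∉ T, ∃ a b, r v a ∧ r v b ∧ ¬ r a b
  · obtain ⟨v, hv, a, b, ha, hb, hab⟩ := hs
    refine le_trans (le_inf ?_ ?_) (relIdeal_completeAt_inf_le r T v)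
    · refine le_trans (iInf₂_mono fun S _ => ?_) (ih _ ?_ (r := completeAt r v) ?_ T rfl)
      · exact relIdeal_mono subset_rfl fun i j _ _ h => Or.inr (h.mono fun _ _ => Or.inl)
      · rw [← hn]
        refine Nat.add_lt_add_right (Finset.card_lt_card ?_) _
        refine ⟨fun p => ?_, fun h => ?_⟩
        · simp only [Finset.mem_filter, Finset.mem_univ, true_and]
          exact fun h h' => h (Or.inl h')
        · have := h (x := (a, b)) (by simpa using hab)
          simp [completeAt, ha, hb] at this
      · rintro a b (h | ⟨h, h'⟩)
        exacts [Or.inl (hr _ _ h), Or.inr ⟨h', h⟩]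
    · refine le_trans (le_iInf₂ fun S hS => ?_) (ih _ ?_ hr (insert v T) rfl)
      · exact iInf₂_le S ((Finset.subset_insert v T).trans hS)
      · rw [← hn]
        refine Nat.add_lt_add_left (Finset.card_lt_card ?_) _
        rw [Finset.compl_ssubset_compl]
        exact Finset.ssubset_insert hv
  -- With nothing left to complete, `r` is transitive through vertices outside `T`, so `Conn r T`
  -- adds only the trivial pairs `i = j`.
  · push Not at hs
    refine (iInf₂_le T subset_rfl).trans (relIdeal_mono subset_rfl fun i j hi hj hij => ?_)
    clear hi hj
    suffices i = j ∨ (r i j ∧ i ∉ T ∧ j ∉ T) from this.imp_right And.left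
    induction hij with
    | rel a b h => exact Or.inr h
    | refl a => exact Or.inl rfl
    | symm a b _ h => exact h.imp Eq.symm fun h => ⟨hr _ _ h.1, h.2.2, h.2.1⟩
    | trans a b c _ _ h h' =>
      rcases h with rfl | h
      · exact h'
      rcases h' with rfl | h'
      · exact Or.inr h
      exact Or.inr ⟨hs b h.2.2 a c (hr _ _ h.1) h'.1, h.2.1, h'.2.2⟩

theorem relIdeal_eq_iInf [Fintype V] {r : V → V → Prop} (hr : ∀ a b, r a b → r b a) :
    relIdeal K r ∅ = ⨅ S, relIdeal K (Conn r S) S := by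
  refine le_antisymm (le_iInf fun S => relIdeal_le_relIdeal_conn r (Finset.empty_subset S)) ?_
  simpa using iInf_relIdeal_conn_le (K := K) hr ∅

end RelIdeal

/-! ### Primality through a toric parametrization -/

section Toric

variable {K : Type*} [Field K] {V : Type*} [Fintype V]

/-- The exponents of the toric parametrization `x_i ↦ u_i s_{c i}`, `y_i ↦ u_i`. -/
noncomputable def toricExp (c : V → V) : V ⊕ V → (V ⊕ V →₀ ℕ) :=
  Sum.elim (fun i => Finsupp.single (Sum.inl i) 1 + Finsupp.single (Sum.inr (c i)) 1)
    fun i => Finsupp.single (Sum.inl i) 1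

/-- The toric parametrization `x_i ↦ u_i s_{c i}`, `y_i ↦ u_i`. -/
noncomputable def toricHom (K : Type*) [Field K] (c : V → V) :
    MvPolynomial (V ⊕ V) K →ₐ[K] MvPolynomial (V ⊕ V) K :=
  aeval fun s => monomial (toricExp c s) 1

/-- The action of `toricHom` on exponents. -/
noncomputable def toricDeg (c : V → V) (a : V ⊕ V →₀ ℕ) : V ⊕ V →₀ ℕ :=
  ∑ s, a s • toricExp c s

theorem toricHom_monomial (c : V → V) (a : V ⊕ V →₀ ℕ) (k : K) :
    toricHom K c (monomial a k) = monomial (toricDeg c a) k := by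
  have : ∏ s, (monomial (toricExp c s) (1 : K)) ^ a s = monomial (toricDeg c a) 1 := by
    rw [toricDeg, monomial_sum_one]
    exact Finset.prod_congr rfl fun s _ => by simp [monomial_pow]
  rw [toricHom, aeval_monomial, Finsupp.prod_fintype _ _ (by simp), this, algebraMap_eq,
    C_mul_monomial, mul_one]

theorem toricDeg_add (c : V → V) (a b : V ⊕ V →₀ ℕ) :
    toricDeg c (a + b) = toricDeg c a + toricDeg c b := by
  simp [toricDeg, add_smul, Finset.sum_add_distrib]

variable [DecidableEq V]

theorem toricDeg_inl (c : V → V) (a : V ⊕ V →₀ ℕ) (i : V) :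
    toricDeg c a (Sum.inl i) = a (Sum.inl i) + a (Sum.inr i) := by
  simp [toricDeg, toricExp, Finsupp.single_apply]

theorem toricDeg_inr (c : V → V) (a : V ⊕ V →₀ ℕ) (l : V) :
    toricDeg c a (Sum.inr l) = ∑ i with c i = l, a (Sum.inl i) := by
  simp [toricDeg, toricExp, Finsupp.single_apply, Finset.sum_filter]

theorem toricDeg_single (c : V → V) (s : V ⊕ V) :
    toricDeg c (Finsupp.single s 1) = toricExp c s := by
  simp [toricDeg, Finsupp.single_apply]

/-- Monomials with the same image under the toric parametrization are congruent. -/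
theorem monomial_sub_monomial_mem (c : V → V) {a b : V ⊕ V →₀ ℕ}
    (h : toricDeg c a = toricDeg c b) :
    monomial a (1 : K) - monomial b 1 ∈ relIdeal K (fun i j => c i = c j) ∅ := by
  induction hn : ∑ i, (a (Sum.inl i) - b (Sum.inl i)) using Nat.strong_induction_on
    generalizing a with
  | _ n ih =>
  have hxy (i : V) : a (Sum.inl i) + a (Sum.inr i) = b (Sum.inl i) + b (Sum.inr i) := by
    simpa [toricDeg_inl] using DFunLike.congr_fun h (Sum.inl i)
  have hsum (l : V) : ∑ i with c i = l, a (Sum.inl i) = ∑ i with c i = l, b (Sum.inl i) := by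
    simpa [toricDeg_inr] using DFunLike.congr_fun h (Sum.inr l)
  by_cases hle : ∀ i, a (Sum.inl i) ≤ b (Sum.inl i)
  · have hx (i : V) : a (Sum.inl i) = b (Sum.inl i) :=
      (Finset.sum_eq_sum_iff_of_le (fun j _ => hle j)).1 (hsum (c i)) i (by simp)
    have : a = b := by
      ext (i | i)
      · exact hx i
      · have := hxy i; have := hx i; omega
    simp [this]
  · push Not at hle
    obtain ⟨i, hi⟩ := hle
    -- Equal exponent sums on each label class force the excess at `i` to be balanced by a deficit
    -- at some `j` of the same class. Trading `x_i y_j` for `x_j y_i` then reduces the total excess.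
    obtain ⟨j, hj, hlt⟩ : ∃ j, c j = c i ∧ a (Sum.inl j) < b (Sum.inl j) := by
      by_contra! hcon
      refine (hsum (c i)).not_gt (Finset.sum_lt_sum (fun j hj => hcon j (by simpa using hj)) ?_)
      exact ⟨i, by simp, hi⟩
    have hij : i ≠ j := by rintro rfl; omega
    have hya : 1 ≤ a (Sum.inr j) := by have := hxy j; omega
    obtain ⟨d, rfl⟩ : ∃ d, a = Finsupp.single (Sum.inl i) 1 + Finsupp.single (Sum.inr j) 1 + d := by
      refine ⟨_, (add_tsub_cancel_of_le (fun s => ?_)).symm⟩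
      rcases s with s | s
      · rcases eq_or_ne i s with rfl | hs
        · simp; omega
        · simp [hs]
      · rcases eq_or_ne j s with rfl | hs
        · simpa
        · simp [hs]
    set a' := Finsupp.single (Sum.inl j) 1 + Finsupp.single (Sum.inr i) 1 + d with ha'
    have hdeg : toricDeg c a' = toricDeg c b := by
      rw [← h]
      simp only [ha', toricDeg_add, toricDeg_single, toricExp, Sum.elim_inl, Sum.elim_inr, hj]
      ac_rfl
    have hmeas : ∑ k, (a' (Sum.inl k) - b (Sum.inl k)) < n := by
      rw [← hn]
      refine Finset.sum_lt_sum (fun k _ => ?_) ⟨i, Finset.mem_univ _, ?_⟩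
      · rcases eq_or_ne j k with rfl | hk
        · simp [ha', hij] at hlt ⊢; omega
        · simp [ha', hk]; omega
      · simp [ha', hij.symm] at hi ⊢; omega
    have hswap : monomial (Finsupp.single (Sum.inl i) 1 + Finsupp.single (Sum.inr j) 1 + d) (1 : K)
        - monomial a' 1 = monomial d 1 * minor K i j := by
      simp only [ha', minor, X, mul_sub, monomial_mul, mul_one, add_comm d]
    rw [← sub_add_sub_cancel _ (monomial a' (1 : K)), hswap]
    exact add_mem (Ideal.mul_mem_left _ _ (minor_mem_relIdeal hj.symm)) (ih _ hmeas hdeg rfl)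

/-- Sending a monomial to the class of a chosen preimage gives a linear `ψ` with `ψ ∘ toricHom`
equal to the quotient map, so the kernel dies in the quotient. Values of `rep` off the image of
`toricDeg` play no role. -/
theorem ker_toricHom_le (c : V → V) {p : MvPolynomial (V ⊕ V) K} (hp : toricHom K c p = 0) :
    p ∈ relIdeal K (fun i j => c i = c j) ∅ := by
  set I := relIdeal K (fun i j : V => c i = c j) ∅
  let rep : (V ⊕ V →₀ ℕ) → (V ⊕ V →₀ ℕ) := Function.invFun (toricDeg c)
  let ψ : MvPolynomial (V ⊕ V) K →ₗ[K] MvPolynomial (V ⊕ V) K ⧸ I :=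
    (basisMonomials (V ⊕ V) K).constr K fun d => Ideal.Quotient.mk I (monomial (rep d) 1)
  have hψ (d) : ψ (monomial d 1) = Ideal.Quotient.mk I (monomial (rep d) 1) := by
    have := (basisMonomials (V ⊕ V) K).constr_basis K
      (fun d => Ideal.Quotient.mk I (monomial (rep d) 1)) d
    simpa using this
  have hcomp : ψ ∘ₗ (toricHom K c).toLinearMap = (Ideal.Quotient.mkₐ K I).toLinearMap := by
    refine (basisMonomials (V ⊕ V) K).ext fun a => ?_
    simp only [coe_basisMonomials, LinearMap.coe_comp, Function.comp_apply,
      AlgHom.toLinearMap_apply, toricHom_monomial, hψ, Ideal.Quotient.mkₐ_eq_mk]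
    exact Ideal.Quotient.eq.2 (monomial_sub_monomial_mem c (Function.invFun_eq ⟨a, rfl⟩))
  have := LinearMap.congr_fun hcomp p
  simp only [LinearMap.coe_comp, Function.comp_apply, AlgHom.toLinearMap_apply, hp, map_zero,
    Ideal.Quotient.mkₐ_eq_mk] at this
  exact Ideal.Quotient.eq_zero_iff_mem.1 this.symm

theorem relIdeal_label_eq_ker (c : V → V) (T : Finset V) :
    relIdeal K (fun i j => c i = c j) T = RingHom.ker ((toricHom K c).comp (kill T)) := by
  refine le_antisymm (relIdeal_le_iff.2 ⟨fun v hv => ?_, fun i j hij => ?_⟩) fun p hp => ?_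
  · simp [RingHom.mem_ker, hv]
  · simp only [RingHom.mem_ker, AlgHom.coe_comp, Function.comp_apply, kill_minor]
    split_ifs
    · simp
    · simp only [minor, toricHom, map_sub, map_mul, aeval_X, toricExp, Sum.elim_inl, Sum.elim_inr,
        monomial_mul, hij]
      rw [sub_eq_zero]
      congr 1
      ac_rfl
  · rw [← sub_add_cancel p (kill T p)]
    refine add_mem (sub_kill_mem (fun v hv => ⟨X_inl_mem_relIdeal hv, X_inr_mem_relIdeal hv⟩) p) ?_
    exact relIdeal_mono (Finset.empty_subset T) (fun _ _ _ _ => Or.inr) (ker_toricHom_le c hp)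

instance isPrime_relIdeal_label (c : V → V) (T : Finset V) :
    (relIdeal K (fun i j => c i = c j) T).IsPrime := by
  rw [relIdeal_label_eq_ker]
  exact RingHom.ker_isPrime _

end Toric

/-! ### Heights of the label primes -/

section Height

variable (K : Type*) [Field K] {V : Type*} [Fintype V]

theorem height_add_coheight_le {K : Type*} [Field K] (P : PrimeSpectrum (MvPolynomial (V ⊕ V) K)) :
    Order.height P + Order.coheight P ≤ ((2 * Fintype.card V : ℕ) : ℕ∞) := by
  have h1 : ringKrullDim (MvPolynomial (V ⊕ V) K) = ((2 * Fintype.card V : ℕ) : ℕ∞) := by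
    rw [MvPolynomial.ringKrullDim_of_isNoetherianRing, ringKrullDim_eq_zero_of_field]
    simp [two_mul]
  rw [ringKrullDim, Order.krullDim_eq_iSup_height_add_coheight_of_nonempty, WithBot.coe_inj] at h1
  exact h1 ▸ le_iSup (fun a => Order.height a + Order.coheight a) P

variable [DecidableEq V]

/-- The prime ideal of a labelled set of vertices, as a point of the spectrum. -/
noncomputable def labelPrime (c : V → V) (T : Finset V) : PrimeSpectrum (MvPolynomial (V ⊕ V) K) :=
  ⟨relIdeal K (fun i j => c i = c j) T, inferInstance⟩

variable {K}

theorem labelPrime_lt_insert (c : V → V) {T : Finset V} {v : V} (hv : v ∉ T) :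
    labelPrime K c T < labelPrime K c (insert v T) := by
  refine lt_of_le_not_ge (relIdeal_mono (Finset.subset_insert v T) fun _ _ _ _ => Or.inr) fun h => ?_
  exact X_inl_notMem_relIdeal _ hv (h (X_inl_mem_relIdeal (Finset.mem_insert_self v T)))

/-- The intermediate prime adds only `x_v`. Setting `x_v = 0` preserves the ideal, because no
nontrivial generating minor outside `T` involves `v`. -/
theorem exists_between_of_isolated (c : V → V) {T : Finset V} {v : V} (hv : v ∉ T)
    (h : ∀ w, w ∉ T → c w = c v → w = v) :
    ∃ P, labelPrime K c T < P ∧ P < labelPrime K c (insert v T) := by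
  let ρ : MvPolynomial (V ⊕ V) K →ₐ[K] MvPolynomial (V ⊕ V) K :=
    aeval fun s => if s = Sum.inl v then 0 else X s
  have hle : relIdeal K (fun i j => c i = c j) T ≤
      (relIdeal K (fun i j => c i = c j) T).comap ρ.toRingHom := by
    refine relIdeal_le_iff.2 ⟨fun w hw => ?_, fun i j hij => ?_⟩
    · have : w ≠ v := by rintro rfl; exact hv hw
      simp [ρ, this, X_inl_mem_relIdeal hw, X_inr_mem_relIdeal hw]
    · by_cases hi : i ∈ T
      · have : i ≠ v := by rintro rfl; exact hv hi
        simp only [minor, AlgHom.toRingHom_eq_coe, Ideal.mem_comap, RingHom.coe_coe, map_sub,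
          map_mul, ρ, aeval_X, Sum.inl.injEq, this, if_false, reduceCtorEq]
        exact sub_mem (Ideal.mul_mem_right _ _ (X_inl_mem_relIdeal hi))
          (Ideal.mul_mem_left _ _ (X_inr_mem_relIdeal hi))
      by_cases hj : j ∈ T
      · have : j ≠ v := by rintro rfl; exact hv hj
        simp only [minor, AlgHom.toRingHom_eq_coe, Ideal.mem_comap, RingHom.coe_coe, map_sub,
          map_mul, ρ, aeval_X, Sum.inl.injEq, this, if_false, reduceCtorEq]
        exact sub_mem (Ideal.mul_mem_left _ _ (X_inr_mem_relIdeal hj))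
          (Ideal.mul_mem_right _ _ (X_inl_mem_relIdeal hj))
      by_cases hiv : i = v
      · have : j = i := by rw [hiv]; exact h j hj (by rw [← hij, hiv])
        rw [this, minor_self]; exact zero_mem _
      by_cases hjv : j = v
      · have : i = j := by rw [hjv]; exact h i hi (by rw [hij, hjv])
        rw [this, minor_self]; exact zero_mem _
      · have : ρ (minor K i j) = minor K i j := by simp [ρ, minor, hiv, hjv]
        change ρ (minor K i j) ∈ relIdeal K (fun i j => c i = c j) T
        rw [this]
        exact minor_mem_relIdeal hij
  refine ⟨⟨(relIdeal K (fun i j => c i = c j) T).comap ρ.toRingHom, inferInstance⟩,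
    lt_of_le_not_ge hle fun h' => ?_, lt_of_le_not_ge (fun p hp => ?_) fun h' => ?_⟩
  · refine X_inl_notMem_relIdeal _ hv (h' ?_)
    simp [ρ]
  · change p ∈ relIdeal K (fun i j => c i = c j) (insert v T)
    rw [← sub_add_cancel p (ρ p)]
    refine add_mem (algHom_sub_mem (fun s => ?_) p)
      (relIdeal_mono (Finset.subset_insert v T) (fun _ _ _ _ => Or.inr) hp)
    by_cases hs : s = Sum.inl v
    · simpa [ρ, hs] using X_inl_mem_relIdeal (Finset.mem_insert_self v T)
    · simp [ρ, hs]
  · have := h' (X_inr_mem_relIdeal (Finset.mem_insert_self v T))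
    refine X_inr_notMem_relIdeal (K := K) (fun i j => c i = c j) hv ?_
    simpa [ρ] using this

/-- Kill the remaining vertices one at a time: each gives one strict inclusion, and two when it is
the last vertex with its label. -/
theorem le_coheight_labelPrime (c : V → V) (T : Finset V) :
    ((Tᶜ.card + (Tᶜ.image c).card : ℕ) : ℕ∞) ≤ Order.coheight (labelPrime K c T) := by
  induction hn : Tᶜ.card generalizing T with
  | zero =>
    rw [Finset.card_eq_zero] at hn
    simp [hn]
  | succ n ih =>
    obtain ⟨v, hv⟩ : Tᶜ.Nonempty := by rw [← Finset.card_pos]; omega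
    have hT : (insert v T)ᶜ = Tᶜ.erase v := by ext; simp
    have ih' := ih (insert v T) (by rw [hT, Finset.card_erase_of_mem hv, hn]; rfl)
    rw [hT] at ih'
    have himg : Tᶜ.image c = insert (c v) ((Tᶜ.erase v).image c) := by
      rw [← Finset.image_insert, Finset.insert_erase hv]
    rw [Finset.mem_compl] at hv
    by_cases hc : c v ∈ (Tᶜ.erase v).image c
    · rw [himg, Finset.insert_eq_of_mem hc]
      refine le_trans ?_ (Order.coheight_add_one_le (labelPrime_lt_insert c hv))
      refine le_trans ?_ (add_le_add_left ih' 1)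
      norm_cast; omega
    · obtain ⟨P, h1, h2⟩ := exists_between_of_isolated (K := K) c hv fun w hw hcw => by
        by_contra hne
        exact hc (Finset.mem_image.2 ⟨w, by simp [hne, hw], hcw⟩)
      rw [himg, Finset.card_insert_of_notMem hc]
      refine le_trans ?_ (Order.coheight_add_one_le h1)
      refine le_trans ?_ (add_le_add_left (Order.coheight_add_one_le h2) 1)
      refine le_trans ?_ (add_le_add_left (add_le_add_left ih' 1) 1)
      norm_cast; omega

theorem labelPrime_congr {c c' : V → V} {T : Finset V} (h : ∀ i, i ∉ T → c i = c' i) :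
    labelPrime K c T = labelPrime K c' T := by
  refine PrimeSpectrum.ext (le_antisymm ?_ ?_) <;>
  · refine relIdeal_mono subset_rfl fun i j hi hj hij => Or.inr ?_
    simpa [h i hi, h j hj] using hij

/-- While two vertices share a label, giving one of them a fresh label yields a strictly smaller
prime and one more label. -/
theorem le_height_labelPrime_empty (c : V → V) (m : ℕ)
    (hm : m + (Finset.univ.image c).card = Fintype.card V) :
    (m : ℕ∞) ≤ Order.height (labelPrime K c ∅) := by
  induction m generalizing c with
  | zero => simp
  | succ m ih =>
    have hinj : ¬ Function.Injective c := fun h => by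
      rw [Finset.card_image_of_injective _ h, Finset.card_univ] at hm; omega
    simp only [Function.Injective, not_forall] at hinj
    obtain ⟨i, j, hij, hne⟩ := hinj
    obtain ⟨l, hl⟩ : ∃ l, l ∉ Finset.univ.image c := by
      by_contra! h
      rw [Finset.eq_univ_iff_forall.2 h, Finset.card_univ] at hm; omega
    have hlc (w : V) : c w ≠ l := fun h => hl (by simp [← h])
    have himg : Finset.univ.image (Function.update c i l) = insert l (Finset.univ.image c) := by
      ext k
      simp only [Finset.mem_image, Finset.mem_univ, true_and, Finset.mem_insert]
      constructor
      · rintro ⟨w, rfl⟩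
        by_cases hw : w = i
        · simp [hw]
        · simp [hw]
      · rintro (rfl | ⟨w, rfl⟩)
        · exact ⟨i, by simp⟩
        · by_cases hw : w = i
          · exact ⟨j, by simp [Ne.symm hne, hw, hij]⟩
          · exact ⟨w, by simp [hw]⟩
    have ih' := ih (Function.update c i l) (by
      rw [himg, Finset.card_insert_of_notMem hl]; omega)
    have hlt : labelPrime K (Function.update c i l) ∅ < labelPrime K c ∅ := by
      refine lt_of_le_not_ge (relIdeal_mono subset_rfl fun a b _ _ hab => ?_) fun h => ?_
      · by_cases ha : a = i <;> by_cases hb : b = i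
        · exact Or.inl (ha.trans hb.symm)
        · simp only [ha, Function.update_self, Function.update_of_ne hb] at hab
          exact absurd hab.symm (hlc b)
        · simp only [hb, Function.update_self, Function.update_of_ne ha] at hab
          exact absurd hab (hlc a)
        · simp only [Function.update_of_ne ha, Function.update_of_ne hb] at hab
          exact Or.inr hab
      · have := rel_of_minor_mem_relIdeal
          (r := fun a b => Function.update c i l a = Function.update c i l b)
          ⟨fun _ => rfl, Eq.symm, Eq.trans⟩ (Finset.notMem_empty i) (Finset.notMem_empty j)
          (h (minor_mem_relIdeal hij))
        simp only [Function.update_self, Function.update_of_ne (Ne.symm hne)] at this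
        exact hlc j this.symm
    refine le_trans ?_ (Order.height_add_one_le hlt)
    push_cast
    gcongr

/-- The label of a killed vertex is irrelevant, so `v` may receive a fresh one. It is then isolated
once removed from the killed set, which gives two strict inclusions. -/
theorem le_height_labelPrime (c : V → V) (T : Finset V) (m : ℕ)
    (hm : m + (Tᶜ.image c).card = Fintype.card V + T.card) :
    (m : ℕ∞) ≤ Order.height (labelPrime K c T) := by
  induction T using Finset.induction_on generalizing c m with
  | empty => exact le_height_labelPrime_empty c m (by simpa using hm)
  | insert v T hv ih =>
    have hT : Tᶜ = insert v (insert v T)ᶜ := by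
      ext w; by_cases h : w = v <;> simp [h, hv]
    have hcard : ((insert v T)ᶜ.image c).card < Fintype.card V := by
      refine Finset.card_image_le.trans_lt ?_
      rw [Finset.card_compl, Finset.card_insert_of_notMem hv]
      have := Fintype.card_pos_iff.2 ⟨v⟩
      omega
    obtain ⟨l, hl⟩ : ∃ l, l ∉ (insert v T)ᶜ.image c := by
      by_contra! h
      rw [Finset.eq_univ_iff_forall.2 h, Finset.card_univ] at hcard; omega
    have hupd : (insert v T)ᶜ.image (Function.update c v l) = (insert v T)ᶜ.image c := by
      refine Finset.image_congr fun w hw => ?_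
      have : w ≠ v := by rintro rfl; simp at hw
      simp [this]
    have himg : Tᶜ.image (Function.update c v l) = insert l ((insert v T)ᶜ.image c) := by
      rw [hT, Finset.image_insert, hupd, Function.update_self]
    have hm2 : 2 ≤ m := by
      rw [Finset.card_insert_of_notMem hv] at hm; omega
    obtain ⟨m, rfl⟩ := Nat.exists_eq_add_of_le' hm2
    have ih' := ih (Function.update c v l) m (by
      rw [himg, Finset.card_insert_of_notMem hl]
      rw [Finset.card_insert_of_notMem hv] at hm; omega)
    obtain ⟨P, h1, h2⟩ := exists_between_of_isolated (K := K) (Function.update c v l) hv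
      fun w hw hcw => by
        by_contra hne
        rw [Function.update_self, Function.update_of_ne hne] at hcw
        exact hl (Finset.mem_image.2 ⟨w, by simp [hne, hw], hcw⟩)
    rw [labelPrime_congr (c := c) (c' := Function.update c v l) fun i hi => by
      have : i ≠ v := by rintro rfl; simp at hi
      simp [this]]
    refine le_trans ?_ (Order.height_add_one_le h2)
    refine le_trans ?_ (add_le_add_left (Order.height_add_one_le h1) 1)
    refine le_trans ?_ (add_le_add_left (add_le_add_left ih' 1) 1)
    norm_cast

/-- The lower bounds for height and coheight add up to `2 * Fintype.card V`, the dimension of the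
ring, so both are equalities. -/
theorem height_labelPrime (c : V → V) (T : Finset V) :
    (relIdeal K (fun i j => c i = c j) T).height + (Tᶜ.image c).card =
      (Fintype.card V + T.card : ℕ) := by
  have hle : (Tᶜ.image c).card ≤ Fintype.card V := Finset.card_le_univ _
  have hT : T.card + Tᶜ.card = Fintype.card V := Finset.card_add_card_compl T
  have h1 := le_height_labelPrime (K := K) c T
    (Fintype.card V + T.card - (Tᶜ.image c).card) (by omega)
  have h2 := le_coheight_labelPrime (K := K) c T
  have h3 := height_add_coheight_le (labelPrime K c T)
  change (labelPrime K c T).asIdeal.height + _ = _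
  rw [PrimeSpectrum.height_eq_orderHeight]
  generalize Order.height (labelPrime K c T) = x at *
  generalize Order.coheight (labelPrime K c T) = y at *
  have hx : x ≠ ⊤ := by
    rintro rfl
    exact ENat.natCast_ne_top _ (top_le_iff.1 (by simpa only [top_add, add_top] using h3))
  have hy : y ≠ ⊤ := by
    rintro rfl
    exact ENat.natCast_ne_top _ (top_le_iff.1 (by simpa only [top_add, add_top] using h3))
  lift x to ℕ using hx
  lift y to ℕ using hy
  norm_cast at *
  omega

end Height

/-! ### Associated primes and the numerical criterion for unmixedness -/

section Components

variable {V : Type*}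

/-- A representative of the component of `i` outside `S`. -/
noncomputable def compLabel (r : V → V → Prop) (S : Finset V) (i : V) : V :=
  Quotient.out (Quotient.mk ⟨Conn r S, conn_equivalence r S⟩ i)

theorem compLabel_eq_iff {r : V → V → Prop} {S : Finset V} {i j : V} :
    compLabel r S i = compLabel r S j ↔ Conn r S i j := by
  rw [compLabel, compLabel, Quotient.out_inj, Quotient.eq]
  rfl

theorem conn_eq_compLabel (r : V → V → Prop) (S : Finset V) :
    Conn r S = fun i j => compLabel r S i = compLabel r S j := by
  funext i j
  exact propext compLabel_eq_iff.symm

theorem relIdeal_conn_le_iff {K : Type*} [Field K] {r : V → V → Prop} {S T : Finset V} :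
    relIdeal K (Conn r T) T ≤ relIdeal K (Conn r S) S ↔
      T ⊆ S ∧ ∀ i j, i ∉ S → j ∉ S → Conn r T i j → Conn r S i j := by
  constructor
  · intro h
    refine ⟨fun v hv => ?_, fun i j hi hj hij => ?_⟩
    · by_contra hvS
      exact X_inl_notMem_relIdeal _ hvS (h (X_inl_mem_relIdeal hv))
    · exact rel_of_minor_mem_relIdeal (conn_equivalence r S) hi hj (h (minor_mem_relIdeal hij))
  · rintro ⟨h1, h2⟩
    exact relIdeal_mono h1 fun i j hi hj hij => Or.inr (h2 i j hi hj hij)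

/-- Every vertex of `S` has neighbours in two components outside `S`. -/
def HasCutProperty (r : V → V → Prop) (S : Finset V) : Prop :=
  ∀ v ∈ S, ∃ a b, a ∉ S ∧ b ∉ S ∧ r v a ∧ r v b ∧ ¬ Conn r S a b

theorem HasCutProperty.eq_of_le {K : Type*} [Field K] {r : V → V → Prop}
    (hr : ∀ a b, r a b → r b a) {S T : Finset V}
    (hS : HasCutProperty r S) (h : relIdeal K (Conn r T) T ≤ relIdeal K (Conn r S) S) : T = S := by
  obtain ⟨h1, h2⟩ := relIdeal_conn_le_iff.1 h
  refine h1.antisymm fun v hv => ?_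
  by_contra hvT
  obtain ⟨a, b, ha, hb, hva, hvb, hab⟩ := hS v hv
  refine hab (h2 a b ha hb (.trans _ v _ (.rel _ _ ⟨hr _ _ hva, ?_, hvT⟩) (.rel _ _ ⟨hvb, hvT, ?_⟩)))
  exacts [fun h => ha (h1 h), fun h => hb (h1 h)]

theorem binomialEdgeIdeal_eq_relIdeal (K : Type*) [Field K] (G : SimpleGraph V) :
    binomialEdgeIdeal K G = relIdeal K G.Adj ∅ := by
  simp [binomialEdgeIdeal, relIdeal, minor]

theorem exists_relIdeal_conn_le_of_isPrime [Fintype V] {K : Type*} [Field K]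
    {r : V → V → Prop} (hr : ∀ a b, r a b → r b a)
    {P : Ideal (MvPolynomial (V ⊕ V) K)} [P.IsPrime] (h : relIdeal K r ∅ ≤ P) :
    ∃ S, relIdeal K (Conn r S) S ≤ P := by
  rw [relIdeal_eq_iInf hr, ← Finset.inf_univ_eq_iInf, Ideal.IsPrime.inf_le' inferInstance] at h
  simpa using h

variable [Fintype V] [DecidableEq V]

/-- The number of components outside `S`. -/
noncomputable def numComp (r : V → V → Prop) (S : Finset V) : ℕ := (Sᶜ.image (compLabel r S)).card

variable (K : Type*) [Field K]

theorem isPrime_relIdeal_conn (r : V → V → Prop) (S : Finset V) :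
    (relIdeal K (Conn r S) S).IsPrime := by
  rw [conn_eq_compLabel]
  infer_instance

theorem height_relIdeal_conn (r : V → V → Prop) (S : Finset V) :
    (relIdeal K (Conn r S) S).height + numComp r S = (Fintype.card V + S.card : ℕ) := by
  rw [conn_eq_compLabel]
  exact height_labelPrime _ _

variable {K}

theorem exists_relIdeal_conn_lt {r : V → V → Prop} (hr : ∀ a b, r a b → r b a) {S : Finset V}
    (hS : ¬ HasCutProperty r S) :
    ∃ T, relIdeal K (Conn r T) T < relIdeal K (Conn r S) S := by
  simp only [HasCutProperty] at hS
  push Not at hS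
  obtain ⟨v, hv, h⟩ := hS
  refine ⟨S.erase v, lt_of_le_not_ge (relIdeal_conn_le_iff.2 ⟨Finset.erase_subset v S, ?_⟩)
    fun hle => Finset.notMem_erase v S ((relIdeal_conn_le_iff.1 hle).1 hv)⟩
  obtain ⟨w, hw⟩ : ∃ w, ∀ a, a ∉ S → r v a → Conn r S w a := by
    by_cases hex : ∃ a, a ∉ S ∧ r v a
    · obtain ⟨a, ha, hva⟩ := hex
      exact ⟨a, fun b hb hvb => h a b ha hb hva hvb⟩
    · push Not at hex
      exact ⟨v, fun a ha hva => absurd hva (hex a ha)⟩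
  -- Replacing `v` by `w` reroutes any connection through `v` so that it avoids `S`.
  have key (i j : V) (hij : Conn r (S.erase v) i j) :
      Conn r S (if i = v then w else i) (if j = v then w else j) := by
    induction hij with
    | rel i j hij =>
      obtain ⟨hij, hi, hj⟩ := hij
      by_cases hiv : i = v <;> by_cases hjv : j = v
      · simp only [hiv, hjv]; exact .refl _
      · simp only [hiv, hjv, if_true, if_false]
        exact hw j (by simpa [hjv] using hj) (hiv ▸ hij)
      · simp only [hiv, hjv, if_true, if_false]
        exact (hw i (by simpa [hiv] using hi) (hjv ▸ hr _ _ hij)).symm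
      · simp only [hiv, hjv, if_false]
        exact .rel _ _ ⟨hij, by simpa [hiv] using hi, by simpa [hjv] using hj⟩
    | refl i => exact .refl _
    | symm i j _ ih => exact ih.symm
    | trans i j k _ _ ih ih' => exact ih.trans _ _ _ ih'
  intro i j hi hj hij
  have := key i j hij
  rwa [if_neg (by rintro rfl; exact hi hv), if_neg (by rintro rfl; exact hj hv)] at this

theorem HasCutProperty.mem_associatedPrimes {r : V → V → Prop} (hr : ∀ a b, r a b → r b a)
    {S : Finset V} (hS : HasCutProperty r S) :
    relIdeal K (Conn r S) S ∈
      associatedPrimes (MvPolynomial (V ⊕ V) K) (MvPolynomial (V ⊕ V) K ⧸ relIdeal K r ∅) := by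
  refine Module.associatedPrimes.minimalPrimes_annihilator_subset_associatedPrimes _ _ ?_
  rw [Ideal.annihilator_quotient]
  refine ⟨⟨isPrime_relIdeal_conn K r S, relIdeal_le_relIdeal_conn r (Finset.empty_subset S)⟩, ?_⟩
  rintro Q ⟨hQ, hJQ⟩ hQS
  obtain ⟨T, hT⟩ := exists_relIdeal_conn_le_of_isPrime hr hJQ
  obtain rfl := hS.eq_of_le hr (hT.trans hQS)
  exact hT

/-- An associated prime is the annihilator of the class of some `f`, hence the intersection of the
P_S not containing `f`; being prime, it is one of them. A strictly smaller P_T would also miss `f`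
and so contain the intersection, which rules out failure of the cut property. -/
theorem exists_eq_of_mem_associatedPrimes {r : V → V → Prop} (hr : ∀ a b, r a b → r b a)
    {P : Ideal (MvPolynomial (V ⊕ V) K)} (hP : P ∈
      associatedPrimes (MvPolynomial (V ⊕ V) K) (MvPolynomial (V ⊕ V) K ⧸ relIdeal K r ∅)) :
    ∃ S, HasCutProperty r S ∧ P = relIdeal K (Conn r S) S := by
  classical
  rw [AssociatedPrimes.mem_iff, isAssociatedPrime_iff] at hP
  obtain ⟨hprime, x, hx⟩ := hP
  obtain ⟨f, rfl⟩ := Ideal.Quotient.mk_surjective x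
  have hmem (p) : p ∈ P ↔ ∀ S, f ∉ relIdeal K (Conn r S) S → p ∈ relIdeal K (Conn r S) S := by
    rw [hx, Submodule.mem_colon_singleton, Submodule.mem_bot,
      show p • Ideal.Quotient.mk (relIdeal K r ∅) f = Ideal.Quotient.mk _ (p * f) from rfl,
      Ideal.Quotient.eq_zero_iff_mem, relIdeal_eq_iInf hr,
      Ideal.mem_iInf]
    refine forall_congr' fun S => ?_
    rw [(isPrime_relIdeal_conn K r S).mul_mem_iff_mem_or_mem]
    tauto
  have hle : (Finset.univ.filter fun S => f ∉ relIdeal K (Conn r S) S).inf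
      (fun S => relIdeal K (Conn r S) S) ≤ P := fun p hp => by
    refine (hmem p).2 fun S hS => ?_
    exact Finset.inf_le (f := fun S => relIdeal K (Conn r S) S) (by simpa using hS) hp
  rw [Ideal.IsPrime.inf_le' hprime] at hle
  obtain ⟨S, hS, hSP⟩ := hle
  have hfS : f ∉ relIdeal K (Conn r S) S := by simpa using hS
  have hPS : P = relIdeal K (Conn r S) S := le_antisymm (fun p hp => (hmem p).1 hp S hfS) hSP
  refine ⟨S, ?_, hPS⟩
  by_contra hcut
  obtain ⟨T, hT⟩ := exists_relIdeal_conn_lt (K := K) hr hcut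
  by_cases hfT : f ∈ relIdeal K (Conn r T) T
  · exact hfS (hT.le hfT)
  · exact hT.not_ge (hPS ▸ fun p hp => (hmem p).1 hp T hfT)

theorem isUnmixed_relIdeal_iff {r : V → V → Prop} (hr : ∀ a b, r a b → r b a)
    (h1 : numComp r ∅ = 1) :
    IsUnmixed (relIdeal K r ∅) ↔ ∀ S, HasCutProperty r S → numComp r S = S.card + 1 := by
  constructor
  · intro h S hS
    have hempty : HasCutProperty r ∅ := by simp [HasCutProperty]
    have hh := (h _ (hS.mem_associatedPrimes hr)).trans (h _ (hempty.mem_associatedPrimes hr)).symm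
    have e1 := height_relIdeal_conn K r S
    have e2 := height_relIdeal_conn K r ∅
    rw [h1] at e2
    rw [hh] at e1
    generalize (relIdeal K (Conn r ∅) ∅).height = x at *
    have hx : x ≠ ⊤ := by
      rintro rfl
      exact ENat.natCast_ne_top _ (by simpa only [top_add] using e1.symm)
    lift x to ℕ using hx
    norm_cast at *
    simp at e2
    omega
  · intro h
    have hh {P} (hP : P ∈ associatedPrimes (MvPolynomial (V ⊕ V) K)
        (MvPolynomial (V ⊕ V) K ⧸ relIdeal K r ∅)) :
        P.height + 1 = Fintype.card V := by
      obtain ⟨S, hS, rfl⟩ := exists_eq_of_mem_associatedPrimes hr hP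
      have e1 := height_relIdeal_conn K r S
      rw [h S hS] at e1
      generalize (relIdeal K (Conn r S) S).height = x at *
      have hx : x ≠ ⊤ := by
        rintro rfl
        exact ENat.natCast_ne_top _ (by simpa only [top_add] using e1.symm)
      lift x to ℕ using hx
      norm_cast at *
      omega
    intro P hP
    refine le_antisymm ?_ ?_
    -- Minimal primes are associated, so the infimum defining the height of the ideal runs over
    -- primes of the same height as `P`.
    · rw [Ideal.height_eq_inf_minimalPrimes (relIdeal K r ∅)]
      refine le_iInf₂ fun Q hQ => le_of_eq ?_
      have hQ' : Q ∈ associatedPrimes (MvPolynomial (V ⊕ V) K)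
          (MvPolynomial (V ⊕ V) K ⧸ relIdeal K r ∅) := by
        refine Module.associatedPrimes.minimalPrimes_annihilator_subset_associatedPrimes _ _ ?_
        rwa [Ideal.annihilator_quotient]
      exact ENat.add_left_injective_of_ne_top ENat.one_ne_top ((hh hP).trans (hh hQ').symm)
    · refine Ideal.height_mono ?_
      obtain ⟨S, -, rfl⟩ := exists_eq_of_mem_associatedPrimes hr hP
      exact relIdeal_le_relIdeal_conn r (Finset.empty_subset S)

end Components

/-! ### Junctions of maximal cliques and separation -/

section Cliques

variable {V : Type*} {G : SimpleGraph V} {F F' : Finset V}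

theorem IsMaxClique.adj (hF : IsMaxClique G F) {a b : V} (ha : a ∈ F) (hb : b ∈ F) (h : a ≠ b) :
    G.Adj a b := hF.prop ha hb h

theorem IsMaxClique.eq_of_subset (hF : IsMaxClique G F) (hF' : IsMaxClique G F') (h : F ⊆ F') :
    F = F' := hF.eq_of_le hF'.prop h

theorem exists_isMaxClique [Finite V] {s : Finset V} (hs : G.IsClique (s : Set V)) :
    ∃ F, s ⊆ F ∧ IsMaxClique G F :=
  (Set.toFinite {s : Finset V | G.IsClique (s : Set V)}).exists_le_maximal hs

theorem exists_isMaxClique_of_adj [Finite V] {a b : V} (h : G.Adj a b) :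
    ∃ F, IsMaxClique G F ∧ a ∈ F ∧ b ∈ F := by
  classical
  obtain ⟨F, hs, hF⟩ := exists_isMaxClique (G := G) (s := {a, b})
    (by simpa [SimpleGraph.isClique_pair] using fun _ => h)
  exact ⟨F, hF, hs (by simp), hs (by simp)⟩

theorem exists_isMaxClique_of_mem [Finite V] (G : SimpleGraph V) (a : V) :
    ∃ F, IsMaxClique G F ∧ a ∈ F := by
  obtain ⟨F, hs, hF⟩ := exists_isMaxClique (G := G) (s := {a}) (by simp)
  exact ⟨F, hF, hs (by simp)⟩

theorem Conn.anti {r : V → V → Prop} {S T : Finset V} (h : S ⊆ T) {a b : V}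
    (hab : Conn r T a b) : Conn r S a b :=
  Relation.EqvGen.mono (fun _ _ hab => ⟨hab.1, fun h' => hab.2.1 (h h'), fun h' => hab.2.2 (h h')⟩)
    _ _ hab

theorem IsMaxClique.conn (hF : IsMaxClique G F) {S : Finset V} {a b : V} (ha : a ∈ F) (hb : b ∈ F)
    (haS : a ∉ S) (hbS : b ∉ S) : Conn G.Adj S a b := by
  rcases eq_or_ne a b with rfl | h
  · exact .refl _
  · exact .rel _ _ ⟨hF.adj ha hb h, haS, hbS⟩

theorem Conn.exists_walk {S : Finset V} {a b : V} (h : Conn G.Adj S a b) (ha : a ∉ S) :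
    ∃ p : G.Walk a b, ∀ x ∈ p.support, x ∉ S := by
  suffices a = b ∨ ∃ p : G.Walk a b, ∀ x ∈ p.support, x ∉ S by
    rcases this with rfl | h
    · exact ⟨.nil, by simpa⟩
    · exact h
  clear ha
  induction h with
  | rel a b h => exact Or.inr ⟨h.1.toWalk, by simpa using h.2⟩
  | refl a => exact Or.inl rfl
  | symm a b _ ih =>
    refine ih.imp Eq.symm ?_
    rintro ⟨p, hp⟩
    exact ⟨p.reverse, by simpa using hp⟩
  | trans a b c _ _ ih ih' =>
    rcases ih with rfl | ⟨p, hp⟩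
    · exact ih'
    rcases ih' with rfl | ⟨q, hq⟩
    · exact Or.inr ⟨p, hp⟩
    refine Or.inr ⟨p.append q, fun x hx => ?_⟩
    rw [SimpleGraph.Walk.mem_support_append_iff] at hx
    exact hx.elim (hp x) (hq x)

/-- A walk can be shortened along a chord. -/
theorem exists_walk_shorter {u w : V} (q : G.Walk u w) {x y : V} (hx : x ∈ q.support)
    (hy : y ∈ q.support) (hxy : G.Adj x y) (he : s(x, y) ∉ q.edges) :
    ∃ p : G.Walk u w, p.length < q.length ∧ ∀ z ∈ p.support, z ∈ q.support := by
  have key (l k : ℕ) (hlk : l < k) (hk : k ≤ q.length) (h : G.Adj (q.getVert l) (q.getVert k))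
      (he : s(q.getVert l, q.getVert k) ∉ q.edges) :
      ∃ p : G.Walk u w, p.length < q.length ∧ ∀ z ∈ p.support, z ∈ q.support := by
    have hne : k ≠ l + 1 := by
      rintro rfl
      exact he (q.mk_mem_edges_iff_exists.2 ⟨l, by omega, rfl⟩)
    refine ⟨(q.take l).append (.cons h (q.drop k)), ?_, fun z hz => ?_⟩
    · simp only [SimpleGraph.Walk.length_append, SimpleGraph.Walk.take_length,
        SimpleGraph.Walk.length_cons, SimpleGraph.Walk.drop_length]
      omega
    · have htake : (q.take l).support ⊆ q.support := (q.isSubwalk_take l).support_subset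
      have hdrop : (q.drop k).support ⊆ q.support := (q.isSubwalk_drop k).support_subset
      rw [SimpleGraph.Walk.mem_support_append_iff, SimpleGraph.Walk.support_cons,
        List.mem_cons] at hz
      rcases hz with hz | rfl | hz
      exacts [htake hz, q.getVert_mem_support l, hdrop hz]
  obtain ⟨l, rfl, hl⟩ := SimpleGraph.Walk.mem_support_iff_exists_getVert.1 hx
  obtain ⟨k, rfl, hk⟩ := SimpleGraph.Walk.mem_support_iff_exists_getVert.1 hy
  rcases lt_trichotomy l k with h | rfl | h
  · exact key l k h hk hxy he
  · exact absurd rfl hxy.ne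
  · exact key k l h hl hxy.symm (by rwa [Sym2.eq_swap])

variable [DecidableEq V]

/-- A nonempty intersection of two distinct maximal cliques. -/
def IsJunction (G : SimpleGraph V) (A : Finset V) : Prop :=
  A.Nonempty ∧ ∃ F₁ F₂, IsMaxClique G F₁ ∧ IsMaxClique G F₂ ∧ F₁ ≠ F₂ ∧ F₁ ∩ F₂ = A

variable {A B : Finset V}

theorem IsJunction.subset_of_mem (hA : IsJunction G A) (hG : IsGeneralizedBlockGraph G)
    (hF : IsMaxClique G F) {a : V} (ha : a ∈ A) (haF : a ∈ F) : A ⊆ F := by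
  obtain ⟨-, F₁, F₂, h1, h2, hne, rfl⟩ := hA
  rw [Finset.mem_inter] at ha
  rcases eq_or_ne F₁ F with rfl | n1
  · exact Finset.inter_subset_left
  rcases eq_or_ne F₂ F with rfl | n2
  · exact Finset.inter_subset_right
  rw [(hG.2 F₁ F₂ F h1 h2 hF hne n1 n2 ⟨a, by simp [ha, haF]⟩).1]
  exact Finset.inter_subset_right

theorem IsJunction.inter_eq (hA : IsJunction G A) (hG : IsGeneralizedBlockGraph G)
    (hF : IsMaxClique G F) (hF' : IsMaxClique G F') (hne : F ≠ F') (h : A ⊆ F) (h' : A ⊆ F') :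
    F ∩ F' = A := by
  have hAJ := hA
  obtain ⟨⟨a, ha⟩, -⟩ := hA
  have haF := h ha
  have haF' := h' ha
  refine le_antisymm ?_ (Finset.subset_inter h h')
  have hJ : IsJunction G (F ∩ F') :=
    ⟨⟨a, Finset.mem_inter.2 ⟨haF, haF'⟩⟩, F, F', hF, hF', hne, rfl⟩
  obtain ⟨-, F₁, F₂, h1, h2, -, rfl⟩ := hAJ
  have hm := Finset.mem_inter.1 ha
  exact Finset.subset_inter
    (hJ.subset_of_mem hG h1 (Finset.mem_inter.2 ⟨haF, haF'⟩) hm.1)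
    (hJ.subset_of_mem hG h2 (Finset.mem_inter.2 ⟨haF, haF'⟩) hm.2)

theorem IsJunction.subset_of_mem_of_mem (hA : IsJunction G A) (hB : IsJunction G B)
    (hG : IsGeneralizedBlockGraph G) {a : V} (ha : a ∈ A) (hb : a ∈ B) : A ⊆ B := by
  obtain ⟨-, F₁, F₂, h1, h2, -, rfl⟩ := hB
  have hm := Finset.mem_inter.1 hb
  exact Finset.subset_inter (hA.subset_of_mem hG h1 ha hm.1) (hA.subset_of_mem hG h2 ha hm.2)

theorem IsJunction.disjoint (hA : IsJunction G A) (hB : IsJunction G B)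
    (hG : IsGeneralizedBlockGraph G) (hne : A ≠ B) : Disjoint A B := by
  rw [Finset.disjoint_left]
  exact fun a ha hb => hne ((hA.subset_of_mem_of_mem hB hG ha hb).antisymm
    (hB.subset_of_mem_of_mem hA hG hb ha))

theorem IsJunction.not_subset (hA : IsJunction G A) (hF : IsMaxClique G F) : ¬ F ⊆ A := by
  obtain ⟨-, F₁, F₂, h1, h2, hne, rfl⟩ := hA
  intro h
  have e1 := hF.eq_of_subset h1 (h.trans Finset.inter_subset_left)
  have e2 := hF.eq_of_subset h2 (h.trans Finset.inter_subset_right)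
  exact hne (e1.symm.trans e2)

/-- A shortest such walk, closed up through a vertex `a` of `A`, is a cycle of length at least 4. A
chord within the walk shortens it; a chord from `a` to an interior vertex lies in a third clique
over `A`, or in `F` or `F'`, and again gives a shorter walk. -/
theorem IsJunction.no_walk [Finite V] (hA : IsJunction G A) (hG : IsGeneralizedBlockGraph G)
    (hF : IsMaxClique G F) (hF' : IsMaxClique G F') (hne : F ≠ F') (hAF : A ⊆ F) (hAF' : A ⊆ F')
    {u w : V} (hu : u ∈ F) (hw : w ∈ F') (p : G.Walk u w) (hp : ∀ x ∈ p.support, x ∉ A) :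
    False := by
  induction hn : p.length using Nat.strong_induction_on generalizing F F' u w with
  | _ n ih =>
  obtain ⟨⟨a, ha⟩, -⟩ := id hA
  have hq := p.bypass_isPath
  have hqA : ∀ x ∈ p.bypass.support, x ∉ A :=
    fun x hx => hp x (p.support_bypass_subset_support hx)
  have hqn : p.bypass.length ≤ n := hn ▸ p.length_bypass_le_length
  generalize p.bypass = q at hq hqA hqn
  have huA : u ∉ A := hqA u q.start_mem_support
  have hwA : w ∉ A := hqA w q.end_mem_support
  have hAmem {z : V} (hz : z ∈ A) {x : V} (hx : x ∉ A) {F : Finset V} (hF : IsMaxClique G F)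
      (hAF : A ⊆ F) (hxF : x ∈ F) : G.Adj z x :=
    hF.adj (hAF hz) hxF (by rintro rfl; exact hx hz)
  have huw : u ≠ w := by
    rintro rfl
    exact huA (hA.inter_eq hG hF hF' hne hAF hAF' ▸ Finset.mem_inter.2 ⟨hu, hw⟩)
  -- Otherwise `A`, `u` and `w` lie in a common maximal clique `E`, and since distinct cliques over
  -- `A` meet exactly in `A`, `E` equals both `F` and `F'`.
  have hnadj : ¬ G.Adj u w := by
    intro hadj
    have hcl : G.IsClique ((insert u (insert w A) : Finset V) : Set V) := by
      rw [Finset.coe_insert, Finset.coe_insert, SimpleGraph.isClique_insert,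
        SimpleGraph.isClique_insert]
      refine ⟨⟨hF.prop.subset (by exact_mod_cast hAF), fun z hz _ =>
        (hAmem hz hwA hF' hAF' hw).symm⟩, fun z hz _ => ?_⟩
      rcases hz with rfl | hz
      · exact hadj
      · exact (hAmem hz huA hF hAF hu).symm
    obtain ⟨E, hE, hEmax⟩ := exists_isMaxClique hcl
    have huE : u ∈ E := hE (by simp)
    have hwE : w ∈ E := hE (by simp)
    have hAE : A ⊆ E := fun z hz => hE (by simp [hz])
    have e1 : E = F := by
      by_contra h
      exact huA (hA.inter_eq hG hEmax hF h hAE hAF ▸ Finset.mem_inter.2 ⟨huE, hu⟩)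
    have e2 : E = F' := by
      by_contra h
      exact hwA (hA.inter_eq hG hEmax hF' h hAE hAF' ▸ Finset.mem_inter.2 ⟨hwE, hw⟩)
    exact hne (e1.symm.trans e2)
  have hlen : 2 ≤ q.length := by
    by_contra hlt
    rcases Nat.lt_or_ge q.length 1 with h | h
    · exact huw (SimpleGraph.Walk.eq_of_length_eq_zero (p := q) (by omega))
    · exact hnadj (SimpleGraph.Walk.adj_of_length_eq_one (p := q) (by omega))
  have hau : G.Adj a u := hAmem ha huA hF hAF hu
  have haw : G.Adj a w := hAmem ha hwA hF' hAF' hw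
  have haq : a ∉ q.support := fun h => hqA a h ha
  have haedge (y : V) : s(a, y) ∉ q.edges := fun h => haq (q.fst_mem_support_of_mem_edges h)
  have hcyc : (SimpleGraph.Walk.cons hau (q.concat haw.symm)).IsCycle := by
    rw [SimpleGraph.Walk.cons_isCycle_iff]
    refine ⟨hq.concat haq _, ?_⟩
    rw [SimpleGraph.Walk.edges_concat, List.concat_eq_append, List.mem_append, not_or]
    refine ⟨haedge u, ?_⟩
    rw [List.mem_singleton, Sym2.eq_swap, Sym2.congr_left]
    exact huw
  obtain ⟨x, hx, y, hy, hxy, he⟩ := hG.1 a _ hcyc (by simp; omega)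
  simp only [SimpleGraph.Walk.support_cons, SimpleGraph.Walk.support_concat, List.mem_cons,
    List.mem_append, List.not_mem_nil, or_false] at hx hy
  simp only [SimpleGraph.Walk.edges_cons, SimpleGraph.Walk.edges_concat, List.mem_cons,
    List.concat_eq_append, List.mem_append, List.not_mem_nil, or_false, not_or] at he
  -- If `E = F`, the tail of `q` from `y` still joins distinct cliques over `A`; otherwise the
  -- initial segment up to `y` does.
  have apex (y : V) (hyq : y ∈ q.support) (hay : G.Adj a y) (h1 : y ≠ u) (h2 : y ≠ w) : False := by
    obtain ⟨E, hE, haE, hyE⟩ := exists_isMaxClique_of_adj hay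
    have hAE := hA.subset_of_mem hG hE ha haE
    by_cases hEF : F = E
    · subst hEF
      exact ih _ ((q.length_dropUntil_lt_length hyq h1).trans_le hqn) hE hF' hne hAF hAF' hyE hw
        (q.dropUntil y hyq) (fun x hx => hqA x (q.support_dropUntil_subset_support hyq hx)) rfl
    · exact ih _ ((q.length_takeUntil_lt_length hyq h2).trans_le hqn) hF hE hEF hAF hAE hu hyE
        (q.takeUntil y hyq) (fun x hx => hqA x (q.support_takeUntil_subset_support hyq hx)) rfl
  have hx' : x = a ∨ x ∈ q.support := by tauto
  have hy' : y = a ∨ y ∈ q.support := by tauto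
  rcases hx' with rfl | hxq <;> rcases hy' with rfl | hyq
  · exact hxy.ne rfl
  · refine apex y hyq hxy ?_ ?_
    · rintro rfl; exact he.1 rfl
    · rintro rfl; exact he.2.2 Sym2.eq_swap
  · refine apex x hxq hxy.symm ?_ ?_
    · rintro rfl; exact he.1 Sym2.eq_swap
    · rintro rfl; exact he.2.2 rfl
  · obtain ⟨p', hp', hsupp⟩ := exists_walk_shorter q hxq hyq hxy he.2.1
    exact ih _ (hp'.trans_le hqn) hF hF' hne hAF hAF' hu hw p' (fun z hz => hqA z (hsupp z hz)) rfl

theorem IsJunction.not_conn [Finite V] (hA : IsJunction G A) (hG : IsGeneralizedBlockGraph G)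
    (hF : IsMaxClique G F) (hF' : IsMaxClique G F') (hne : F ≠ F') (hAF : A ⊆ F) (hAF' : A ⊆ F')
    {u w : V} (hu : u ∈ F) (hw : w ∈ F') (huA : u ∉ A) : ¬ Conn G.Adj A u w := by
  intro h
  obtain ⟨p, hp⟩ := h.exists_walk huA
  exact hA.no_walk hG hF hF' hne hAF hAF' hu hw p hp

end Cliques

/-! ### Counting components after deleting junctions -/

section Counting

theorem card_image_eq_card_image {α β γ : Type*} [DecidableEq β] [DecidableEq γ] {s : Finset α}
    {f : α → β} {g : α → γ} (h : ∀ x ∈ s, ∀ y ∈ s, f x = f y ↔ g x = g y) :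
    (s.image f).card = (s.image g).card := by
  have h1 : s.image f = (s.image fun x => (f x, g x)).image Prod.fst := by
    rw [Finset.image_image]; rfl
  have h2 : s.image g = (s.image fun x => (f x, g x)).image Prod.snd := by
    rw [Finset.image_image]; rfl
  have inj1 : Set.InjOn Prod.fst (s.image fun x => (f x, g x) : Set (β × γ)) := by
    rw [Finset.coe_image]
    rintro _ ⟨x, hx, rfl⟩ _ ⟨y, hy, rfl⟩ hxy
    exact Prod.ext hxy ((h x hx y hy).1 hxy)
  have inj2 : Set.InjOn Prod.snd (s.image fun x => (f x, g x) : Set (β × γ)) := by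
    rw [Finset.coe_image]
    rintro _ ⟨x, hx, rfl⟩ _ ⟨y, hy, rfl⟩ hxy
    exact Prod.ext ((h x hx y hy).2 hxy) hxy
  rw [h1, h2, Finset.card_image_of_injOn inj1, Finset.card_image_of_injOn inj2]

variable {V : Type*} [DecidableEq V] {G : SimpleGraph V} {A S : Finset V}

theorem IsJunction.conn_of_mem (hA : IsJunction G A) (hd : Disjoint S A) {a b : V} (ha : a ∈ A)
    (hb : b ∈ A) : Conn G.Adj S a b := by
  obtain ⟨-, F₁, F₂, h1, h2, hne, rfl⟩ := hA
  exact h1.conn (Finset.mem_inter.1 ha).1 (Finset.mem_inter.1 hb).1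
    (Finset.disjoint_right.1 hd ha) (Finset.disjoint_right.1 hd hb)

/-- Deleting `A` affects only the component that contains it. -/
theorem conn_or_conn_union (hA : IsJunction G A) (hd : Disjoint S A) {a x y : V} (ha : a ∈ A)
    (h : Conn G.Adj S x y) : Conn G.Adj S x a ∨ Conn G.Adj (S ∪ A) x y := by
  induction h with
  | rel x y h =>
    by_cases hx : x ∈ A
    · exact Or.inl (hA.conn_of_mem hd hx ha)
    by_cases hy : y ∈ A
    · exact Or.inl (.trans _ _ _ (.rel _ _ h) (hA.conn_of_mem hd hy ha))
    · exact Or.inr (.rel _ _ ⟨h.1, by simp [h.2.1, hx], by simp [h.2.2, hy]⟩)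
  | refl x => exact Or.inr (.refl _)
  | symm x y h ih => exact ih.imp (fun h' => .trans _ _ _ h.symm h') fun h' => h'.symm
  | trans x y z h _ ih ih' =>
    rcases ih with ih | ih
    · exact Or.inl ih
    rcases ih' with ih' | ih'
    · exact Or.inl (.trans _ _ _ h ih')
    · exact Or.inr (.trans _ _ _ ih ih')

theorem exists_conn_adj_of_walk {x z : V} (p : G.Walk x z) (hz : z ∈ A)
    (hp : ∀ y ∈ p.support, y ∉ S) (hx : x ∉ A) :
    ∃ w a, w ∉ S ∪ A ∧ a ∈ A ∧ G.Adj w a ∧ Conn G.Adj (S ∪ A) x w := by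
  induction p with
  | nil => exact absurd hz hx
  | @cons x y z h p ih =>
    have hxS : x ∉ S := hp x (by simp)
    by_cases hy : y ∈ A
    · exact ⟨x, y, by simp [hxS, hx], hy, h, .refl _⟩
    · obtain ⟨w, a, hw, ha, hwa, hyw⟩ := ih hz (fun y hy => hp y (by simp [hy])) hy
      have hyS : y ∉ S := hp y (by simp)
      exact ⟨w, a, hw, ha, hwa, .trans _ _ _ (.rel _ _ ⟨h, by simp [hxS, hx], by simp [hyS, hy]⟩) hyw⟩

theorem disjoint_sup_of_notMem (hG : IsGeneralizedBlockGraph G) {𝒮 : Finset (Finset V)}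
    (h𝒮 : ∀ B ∈ 𝒮, IsJunction G B) (hA : IsJunction G A) (hnot : A ∉ 𝒮) :
    Disjoint (𝒮.sup id) A := by
  rw [Finset.disjoint_sup_left]
  exact fun B hB => (h𝒮 B hB).disjoint hA hG (by rintro rfl; exact hnot hB)

theorem card_sup_eq_sum (hG : IsGeneralizedBlockGraph G) (𝒮 : Finset (Finset V))
    (h𝒮 : ∀ A ∈ 𝒮, IsJunction G A) : (𝒮.sup id).card = ∑ A ∈ 𝒮, A.card := by
  rw [Finset.sup_eq_biUnion, Finset.card_biUnion]
  · rfl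
  · exact fun A hA B hB hne => (h𝒮 A hA).disjoint (h𝒮 B hB) hG hne

variable [Fintype V]

open Classical in
/-- The maximal cliques that contain `A`. -/
noncomputable def cliquesOver (G : SimpleGraph V) (A : Finset V) : Finset (Finset V) :=
  Finset.univ.filter fun F => IsMaxClique G F ∧ A ⊆ F

open Classical in
/-- The maximal cliques contained in `S`. -/
noncomputable def cliquesIn (G : SimpleGraph V) (S : Finset V) : Finset (Finset V) :=
  Finset.univ.filter fun F => IsMaxClique G F ∧ F ⊆ S

@[simp] theorem mem_cliquesOver {F : Finset V} :
    F ∈ cliquesOver G A ↔ IsMaxClique G F ∧ A ⊆ F := by simp [cliquesOver]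

@[simp] theorem mem_cliquesIn {F : Finset V} :
    F ∈ cliquesIn G S ↔ IsMaxClique G F ∧ F ⊆ S := by simp [cliquesIn]

theorem IsJunction.two_le_card_cliquesOver (hA : IsJunction G A) :
    2 ≤ (cliquesOver G A).card := by
  obtain ⟨-, F₁, F₂, h1, h2, hne, rfl⟩ := hA
  exact Finset.one_lt_card.2 ⟨F₁, by simp [h1], F₂, by simp [h2], hne⟩

/-- The components outside `S ∪ A` that touch the junction `A` correspond to the maximal cliques
over `A` that are not contained in `S ∪ A`. -/
theorem card_image_touching (hA : IsJunction G A) (hG : IsGeneralizedBlockGraph G)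
    (hd : Disjoint S A) {a : V} (ha : a ∈ A) (X : Finset V)
    (hX : ∀ x, x ∈ X ↔ x ∉ S ∪ A ∧ Conn G.Adj S x a) :
    (X.image (compLabel G.Adj (S ∪ A))).card =
      ((cliquesOver G A).filter fun F => ¬ F ⊆ S ∪ A).card := by
  symm
  have hex (F : Finset V) (hF : F ∈ (cliquesOver G A).filter fun F => ¬ F ⊆ S ∪ A) :
      ∃ v, v ∈ F ∧ v ∉ S ∪ A := Finset.not_subset.1 (Finset.mem_filter.1 hF).2
  choose v hvF hv using hex
  refine Finset.card_bij (fun F hF => compLabel G.Adj (S ∪ A) (v F hF)) ?_ ?_ ?_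
  · intro F hF
    have h1 := mem_cliquesOver.1 (Finset.mem_filter.1 hF).1
    refine Finset.mem_image_of_mem _ ((hX _).2 ⟨hv F hF, ?_⟩)
    exact h1.1.conn (hvF F hF) (h1.2 ha) (fun h => hv F hF (Finset.mem_union_left _ h))
      (Finset.disjoint_right.1 hd ha)
  · intro F hF F' hF' heq
    have h1 := mem_cliquesOver.1 (Finset.mem_filter.1 hF).1
    have h2 := mem_cliquesOver.1 (Finset.mem_filter.1 hF').1
    by_contra hne
    refine hA.not_conn hG h1.1 h2.1 hne h1.2 h2.2 (hvF F hF) (hvF F' hF')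
      (fun h => hv F hF (Finset.mem_union_right _ h)) ?_
    exact (compLabel_eq_iff.1 heq).anti Finset.subset_union_right
  · intro l hl
    obtain ⟨x, hx, rfl⟩ := Finset.mem_image.1 hl
    obtain ⟨hxS, hxa⟩ := (hX x).1 hx
    obtain ⟨p, hp⟩ := hxa.exists_walk fun h => hxS (Finset.mem_union_left _ h)
    obtain ⟨w, b, hw, hb, hwb, hxw⟩ := exists_conn_adj_of_walk p ha hp
      fun h => hxS (Finset.mem_union_right _ h)
    obtain ⟨F, hF, hwF, hbF⟩ := exists_isMaxClique_of_adj hwb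
    have hAF := hA.subset_of_mem hG hF hb hbF
    have hmem : F ∈ (cliquesOver G A).filter fun F => ¬ F ⊆ S ∪ A :=
      Finset.mem_filter.2 ⟨mem_cliquesOver.2 ⟨hF, hAF⟩, fun h => hw (h hwF)⟩
    refine ⟨F, hmem, compLabel_eq_iff.2 ?_⟩
    exact .trans _ _ _ (hF.conn (hvF F hmem) hwF (hv F hmem) hw) hxw.symm

/-- The component containing `A` is replaced by one piece for each clique over `A` that survives,
and the others are unchanged. -/
theorem numComp_union (hA : IsJunction G A) (hG : IsGeneralizedBlockGraph G)
    (hd : Disjoint S A) :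
    numComp G.Adj (S ∪ A) + 1 =
      numComp G.Adj S + ((cliquesOver G A).filter fun F => ¬ F ⊆ S ∪ A).card := by
  classical
  obtain ⟨a, ha⟩ := hA.1
  let X := (S ∪ A)ᶜ.filter fun x => Conn G.Adj S x a
  let Y := (S ∪ A)ᶜ.filter fun x => ¬ Conn G.Adj S x a
  have hXmem (x : V) : x ∈ X ↔ x ∉ S ∪ A ∧ Conn G.Adj S x a := by
    simp [X]
  have hYmem (x : V) : x ∈ Y ↔ x ∉ S ∪ A ∧ ¬ Conn G.Adj S x a := by
    simp [Y]
  have hXY : (S ∪ A)ᶜ = X ∪ Y := (Finset.filter_union_filter_not_eq _ _).symm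
  have h1 : Sᶜ.image (compLabel G.Adj S) =
      insert (compLabel G.Adj S a) (Y.image (compLabel G.Adj S)) := by
    ext l
    simp only [Finset.mem_image, Finset.mem_compl, Finset.mem_insert]
    constructor
    · rintro ⟨x, hx, rfl⟩
      by_cases hxa : Conn G.Adj S x a
      · exact Or.inl (compLabel_eq_iff.2 hxa)
      · refine Or.inr ⟨x, (hYmem x).2 ⟨?_, hxa⟩, rfl⟩
        rw [Finset.mem_union, not_or]
        exact ⟨hx, fun h => hxa (hA.conn_of_mem hd h ha)⟩
    · rintro (rfl | ⟨x, hx, rfl⟩)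
      · exact ⟨a, Finset.disjoint_right.1 hd ha, rfl⟩
      · exact ⟨x, fun h => ((hYmem x).1 hx).1 (Finset.mem_union_left _ h), rfl⟩
  have h2 : compLabel G.Adj S a ∉ Y.image (compLabel G.Adj S) := by
    intro h
    obtain ⟨x, hx, hxa⟩ := Finset.mem_image.1 h
    exact ((hYmem x).1 hx).2 (compLabel_eq_iff.1 hxa)
  have h3 : Disjoint (X.image (compLabel G.Adj (S ∪ A))) (Y.image (compLabel G.Adj (S ∪ A))) := by
    rw [Finset.disjoint_left]
    intro l hl hl'
    obtain ⟨x, hx, rfl⟩ := Finset.mem_image.1 hl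
    obtain ⟨y, hy, hxy⟩ := Finset.mem_image.1 hl'
    refine ((hYmem y).1 hy).2 (.trans _ _ _ ?_ ((hXmem x).1 hx).2)
    exact (compLabel_eq_iff.1 hxy).anti Finset.subset_union_left
  have h4 : (Y.image (compLabel G.Adj S)).card = (Y.image (compLabel G.Adj (S ∪ A))).card := by
    refine card_image_eq_card_image fun x hx y _ => ?_
    rw [compLabel_eq_iff, compLabel_eq_iff]
    exact ⟨fun h => (conn_or_conn_union hA hd ha h).resolve_left ((hYmem x).1 hx).2,
      fun h => h.anti Finset.subset_union_left⟩
  rw [numComp, numComp, h1, Finset.card_insert_of_notMem h2, hXY, Finset.image_union,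
    Finset.card_union_of_disjoint h3, h4, card_image_touching hA hG hd ha X hXmem]
  omega

/-- Counting swallowed cliques complements `numComp_union`: the sum of both counts grows by the
number of cliques over `A` minus one, whichever of them survive. -/
theorem card_cliquesIn_union (hA : IsJunction G A) (hG : IsGeneralizedBlockGraph G)
    (hd : Disjoint S A) :
    (cliquesIn G (S ∪ A)).card =
      (cliquesIn G S).card + ((cliquesOver G A).filter fun F => F ⊆ S ∪ A).card := by
  rw [← Finset.card_union_of_disjoint]
  · congr 1
    ext F
    simp only [mem_cliquesIn, Finset.mem_union, Finset.mem_filter, mem_cliquesOver]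
    constructor
    · rintro ⟨hF, hFS⟩
      by_cases h : ∃ a ∈ A, a ∈ F
      · obtain ⟨a, ha, haF⟩ := h
        exact Or.inr ⟨⟨hF, hA.subset_of_mem hG hF ha haF⟩, hFS⟩
      · push Not at h
        refine Or.inl ⟨hF, fun x hx => (Finset.mem_union.1 (hFS hx)).resolve_right ?_⟩
        exact fun h' => h x h' hx
    · rintro (⟨hF, hFS⟩ | ⟨⟨hF, -⟩, hFS⟩)
      · exact ⟨hF, hFS.trans Finset.subset_union_left⟩
      · exact ⟨hF, hFS⟩
  · rw [Finset.disjoint_left]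
    intro F h1 h2
    obtain ⟨a, ha⟩ := hA.1
    have hAF := (mem_cliquesOver.1 (Finset.mem_filter.1 h2).1).2
    exact Finset.disjoint_right.1 hd ha ((mem_cliquesIn.1 h1).2 (hAF ha))

theorem numComp_empty (hconn : G.Connected) : numComp G.Adj ∅ = 1 := by
  have : Nonempty V := hconn.nonempty
  rw [numComp, Finset.card_eq_one]
  obtain ⟨v⟩ := this
  refine ⟨compLabel G.Adj ∅ v, ?_⟩
  ext l
  simp only [Finset.compl_empty, Finset.mem_image, Finset.mem_univ, true_and,
    Finset.mem_singleton]
  constructor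
  · rintro ⟨x, rfl⟩
    rw [compLabel_eq_iff]
    have := (SimpleGraph.reachable_iff_reflTransGen x v).1 (hconn.preconnected x v)
    induction this with
    | refl => exact .refl _
    | tail _ h ih => exact .trans _ _ _ ih (.rel _ _ ⟨h, by simp, by simp⟩)
  · rintro rfl
    exact ⟨v, rfl⟩

/-- The number of components left after removing a union of junctions. -/
theorem numComp_sup (hconn : G.Connected) (hG : IsGeneralizedBlockGraph G)
    (𝒮 : Finset (Finset V)) (h𝒮 : ∀ A ∈ 𝒮, IsJunction G A) :
    numComp G.Adj (𝒮.sup id) + (cliquesIn G (𝒮.sup id)).card + 𝒮.card =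
      1 + ∑ A ∈ 𝒮, (cliquesOver G A).card := by
  induction 𝒮 using Finset.induction_on with
  | empty =>
    have : cliquesIn G ∅ = ∅ := by
      refine Finset.eq_empty_of_forall_notMem fun F hF => ?_
      obtain ⟨hF, hF0⟩ := mem_cliquesIn.1 hF
      have : Nonempty V := hconn.nonempty
      obtain ⟨v⟩ := this
      obtain ⟨F', hF', hv⟩ := exists_isMaxClique_of_mem G v
      have := hF.eq_of_subset hF' (hF0.trans (Finset.empty_subset _))
      exact Finset.notMem_empty v (hF0 (this ▸ hv))
    simp [numComp_empty hconn, this]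
  | insert A 𝒮 hnot ih =>
    have ih' := ih fun B hB => h𝒮 B (Finset.mem_insert_of_mem hB)
    have hA := h𝒮 A (Finset.mem_insert_self A 𝒮)
    have hd := disjoint_sup_of_notMem hG (fun B hB => h𝒮 B (Finset.mem_insert_of_mem hB)) hA hnot
    have hsup : (insert A 𝒮).sup id = 𝒮.sup id ∪ A := by
      rw [Finset.sup_insert, sup_comm]; rfl
    rw [hsup, Finset.sum_insert hnot, Finset.card_insert_of_notMem hnot,
      card_cliquesIn_union hA hG hd]
    have h1 := numComp_union hA hG hd
    have h2 := Finset.card_filter_add_card_filter_not (s := cliquesOver G A)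
      (fun F => F ⊆ 𝒮.sup id ∪ A)
    omega

theorem numComp_sup_of_card (hconn : G.Connected) (hG : IsGeneralizedBlockGraph G)
    (hcard : ∀ A, IsJunction G A → (cliquesOver G A).card = A.card + 1)
    (𝒮 : Finset (Finset V)) (h𝒮 : ∀ A ∈ 𝒮, IsJunction G A) :
    numComp G.Adj (𝒮.sup id) + (cliquesIn G (𝒮.sup id)).card = (𝒮.sup id).card + 1 := by
  have h1 := numComp_sup hconn hG 𝒮 h𝒮
  have h2 : ∑ A ∈ 𝒮, (cliquesOver G A).card = ∑ A ∈ 𝒮, (A.card + 1) :=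
    Finset.sum_congr rfl fun A hA => hcard A (h𝒮 A hA)
  rw [h2, Finset.sum_add_distrib, Finset.sum_const, smul_eq_mul, mul_one,
    ← card_sup_eq_sum hG 𝒮 h𝒮] at h1
  omega

theorem IsJunction.numComp_eq (hconn : G.Connected) (hG : IsGeneralizedBlockGraph G)
    (hA : IsJunction G A) : numComp G.Adj A = (cliquesOver G A).card := by
  have h := numComp_sup hconn hG {A} (by simpa using hA)
  have : cliquesIn G A = ∅ := Finset.eq_empty_of_forall_notMem fun F hF =>
    hA.not_subset (mem_cliquesIn.1 hF).1 (mem_cliquesIn.1 hF).2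
  simp [this] at h
  omega

end Counting

/-! ### Minimal cut sets, the cut property and conditions (a) and (b) -/

section CutSets

variable {V : Type*} [Fintype V] [DecidableEq V] {G : SimpleGraph V} {A S : Finset V}

theorem card_connectedComponent_induce (G : SimpleGraph V) (S : Finset V) :
    Nat.card (G.induce ((S : Set V)ᶜ)).ConnectedComponent = numComp G.Adj S := by
  classical
  have hreach (x y : ((S : Set V)ᶜ : Set V)) :
      (G.induce ((S : Set V)ᶜ)).Reachable x y ↔ Conn G.Adj S x y := by
    constructor
    · intro h
      rw [SimpleGraph.reachable_iff_reflTransGen] at h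
      induction h with
      | refl => exact .refl _
      | @tail y z _ h ih =>
        exact .trans _ _ _ ih (.rel _ _ ⟨h, mt Finset.mem_coe.2 y.2, mt Finset.mem_coe.2 z.2⟩)
    · intro h
      obtain ⟨p, hp⟩ := h.exists_walk (mt Finset.mem_coe.2 x.2)
      exact ⟨p.induce _ (by simpa using hp)⟩
  let f : (G.induce ((S : Set V)ᶜ)).ConnectedComponent → V :=
    Quot.lift (fun x => compLabel G.Adj S x) fun x y h => compLabel_eq_iff.2 ((hreach x y).1 h)
  have hf : Function.Injective f := by
    rintro ⟨x⟩ ⟨y⟩ hxy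
    exact Quot.sound ((hreach x y).2 (compLabel_eq_iff.1 hxy))
  rw [numComp, Nat.card_eq_fintype_card, ← Finset.card_univ, ← Finset.card_image_of_injective _ hf]
  congr 1
  ext l
  simp only [Finset.mem_image, Finset.mem_univ, true_and, Finset.mem_compl]
  constructor
  · rintro ⟨⟨x⟩, rfl⟩
    exact ⟨x, mt Finset.mem_coe.2 x.2, rfl⟩
  · rintro ⟨x, hx, rfl⟩
    exact ⟨SimpleGraph.connectedComponentMk _ ⟨x, by simpa using hx⟩, rfl⟩

theorem isCutSet_iff (hconn : G.Connected) : IsCutSet G A ↔ 1 < numComp G.Adj A := by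
  rw [IsCutSet, card_connectedComponent_induce]
  have : Nat.card G.ConnectedComponent = 1 := by
    have := hconn.preconnected.subsingleton_connectedComponent
    have : Nonempty V := hconn.nonempty
    exact Nat.card_eq_one_iff_unique.2 ⟨inferInstance, inferInstance⟩
  rw [this]

/-- Follow the cliques along the walk: consecutive distinct ones meet in a junction, which has a
vertex outside `S` through which to pass, even where the walk itself enters `S`. -/
theorem conn_of_walk (hS : ∀ A, IsJunction G A → ¬ A ⊆ S) {v w : V} (p : G.Walk v w)
    (hw : w ∉ S) {F : Finset V} (hF : IsMaxClique G F) (hv : v ∈ F) {u : V} (hu : u ∈ F)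
    (huS : u ∉ S) : Conn G.Adj S u w := by
  induction p generalizing F u with
  | nil => exact hF.conn hu hv huS hw
  | @cons v v' w h p ih =>
    obtain ⟨F', hF', hvF', hv'F'⟩ := exists_isMaxClique_of_adj h
    rcases eq_or_ne F F' with rfl | hne
    · exact ih hw hF hv'F' hu huS
    · obtain ⟨a, ha, haS⟩ := Finset.not_subset.1 (hS (F ∩ F')
        ⟨⟨v, Finset.mem_inter.2 ⟨hv, hvF'⟩⟩, F, F', hF, hF', hne, rfl⟩)
      rw [Finset.mem_inter] at ha
      exact .trans _ _ _ (hF.conn hu ha.1 huS haS) (ih hw hF' hv'F' ha.2 haS)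

theorem IsCutSet.exists_junction (hconn : G.Connected) (hS : IsCutSet G S) :
    ∃ A, IsJunction G A ∧ A ⊆ S := by
  by_contra! hcon
  rw [isCutSet_iff hconn, numComp, Finset.one_lt_card] at hS
  obtain ⟨a, ha, b, hb, hab⟩ := hS
  obtain ⟨x, hx, rfl⟩ := Finset.mem_image.1 ha
  obtain ⟨y, hy, rfl⟩ := Finset.mem_image.1 hb
  rw [Finset.mem_compl] at hx hy
  obtain ⟨F, hF, hxF⟩ := exists_isMaxClique_of_mem G x
  obtain ⟨p⟩ := hconn.preconnected x y
  exact hab (compLabel_eq_iff.2 (conn_of_walk hcon p hy hF hxF hxF hx))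

theorem IsJunction.isCutSet (hconn : G.Connected) (hG : IsGeneralizedBlockGraph G)
    (hA : IsJunction G A) : IsCutSet G A := by
  rw [isCutSet_iff hconn, hA.numComp_eq hconn hG]
  exact hA.two_le_card_cliquesOver

theorem isMinimalCutSet_iff (hconn : G.Connected) (hG : IsGeneralizedBlockGraph G) :
    IsMinimalCutSet G A ↔ IsJunction G A := by
  constructor
  · intro h
    obtain ⟨B, hB, hBA⟩ := IsCutSet.exists_junction hconn h.prop
    exact h.eq_of_le (hB.isCutSet hconn hG) hBA ▸ hB
  · intro hA
    refine ⟨hA.isCutSet hconn hG, fun B hB hBA => ?_⟩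
    obtain ⟨C, hC, hCB⟩ := IsCutSet.exists_junction hconn hB
    obtain ⟨c, hc⟩ := hC.1
    exact (hA.subset_of_mem_of_mem hC hG (hBA (hCB hc)) hc).trans hCB

/-- The family is forced: its members contain `A`, and every other maximal clique is disjoint from
the nonempty set `A`. -/
theorem isTMinimalCutSet_iff (hconn : G.Connected) (hG : IsGeneralizedBlockGraph G) {t : ℕ} :
    IsTMinimalCutSet G t A ↔ IsJunction G A ∧ t = (cliquesOver G A).card := by
  rw [IsTMinimalCutSet, isMinimalCutSet_iff hconn hG]
  refine and_congr_right fun hA => ?_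
  obtain ⟨a, ha⟩ := hA.1
  constructor
  · rintro ⟨𝓕, rfl, hmax, hinf, hdisj⟩
    congr 1
    ext F
    rw [mem_cliquesOver]
    refine ⟨fun hF => ⟨hmax F hF, hinf ▸ Finset.inf_le (f := id) hF⟩, fun ⟨hF, hAF⟩ => ?_⟩
    by_contra hnot
    exact Finset.disjoint_left.1 (hdisj F hF hnot) (hAF ha) ha
  · rintro rfl
    refine ⟨cliquesOver G A, rfl, fun F hF => (mem_cliquesOver.1 hF).1, ?_, fun F hF hnot => ?_⟩
    · refine le_antisymm ?_ (Finset.le_inf fun F hF => (mem_cliquesOver.1 hF).2)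
      obtain ⟨-, F₁, F₂, h1, h2, hne, rfl⟩ := hA
      exact Finset.subset_inter
        (Finset.inf_le (f := id) (mem_cliquesOver.2 ⟨h1, Finset.inter_subset_left⟩))
        (Finset.inf_le (f := id) (mem_cliquesOver.2 ⟨h2, Finset.inter_subset_right⟩))
    · rw [Finset.disjoint_right]
      exact fun b hb hbF => hnot (mem_cliquesOver.2 ⟨hF, hA.subset_of_mem hG hF hb hbF⟩)

/-- Two cliques through a vertex of a set with the cut property that leave the set. -/
theorem HasCutProperty.exists_cliques (hS : HasCutProperty G.Adj S) {v : V} (hv : v ∈ S) :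
    ∃ F₁ F₂, IsMaxClique G F₁ ∧ IsMaxClique G F₂ ∧ F₁ ≠ F₂ ∧ v ∈ F₁ ∧ v ∈ F₂ ∧
      ¬ F₁ ⊆ S ∧ ¬ F₂ ⊆ S ∧ F₁ ∩ F₂ ⊆ S := by
  obtain ⟨a, b, ha, hb, hva, hvb, hab⟩ := hS v hv
  obtain ⟨F₁, h1, hv1, ha1⟩ := exists_isMaxClique_of_adj hva
  obtain ⟨F₂, h2, hv2, hb2⟩ := exists_isMaxClique_of_adj hvb
  refine ⟨F₁, F₂, h1, h2, ?_, hv1, hv2, fun h => ha (h ha1), fun h => hb (h hb2), fun w hw => ?_⟩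
  · rintro rfl
    exact hab (h1.conn ha1 hb2 ha hb)
  · by_contra hwS
    rw [Finset.mem_inter] at hw
    exact hab (.trans _ _ _ (h1.conn ha1 hw.1 ha hwS) (h2.conn hw.2 hb2 hwS hb))

theorem IsJunction.hasCutProperty_of_two_le (hA : IsJunction G A) (hG : IsGeneralizedBlockGraph G)
    (hAS : A ⊆ S) (h : 2 ≤ ((cliquesOver G A).filter fun F => ¬ F ⊆ S).card) {v : V}
    (hv : v ∈ A) : ∃ a b, a ∉ S ∧ b ∉ S ∧ G.Adj v a ∧ G.Adj v b ∧ ¬ Conn G.Adj S a b := by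
  obtain ⟨F₁, h1, F₂, h2, hne⟩ := Finset.one_lt_card.1 h
  simp only [Finset.mem_filter, mem_cliquesOver] at h1 h2
  obtain ⟨a, ha, haS⟩ := Finset.not_subset.1 h1.2
  obtain ⟨b, hb, hbS⟩ := Finset.not_subset.1 h2.2
  refine ⟨a, b, haS, hbS, h1.1.1.adj (h1.1.2 hv) ha ?_, h2.1.1.adj (h2.1.2 hv) hb ?_, fun hab => ?_⟩
  · rintro rfl; exact haS (hAS hv)
  · rintro rfl; exact hbS (hAS hv)
  · exact hA.not_conn hG h1.1.1 h2.1.1 hne h1.1.2 h2.1.2 ha hb (fun h => haS (hAS h)) (hab.anti hAS)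

/-- No maximal clique fits inside a junction, so `A` has the cut property and leaves one component
per clique over it. -/
theorem card_cliquesOver_of_unmixed (hconn : G.Connected) (hG : IsGeneralizedBlockGraph G)
    (h : ∀ S, HasCutProperty G.Adj S → numComp G.Adj S = S.card + 1) (hA : IsJunction G A) :
    (cliquesOver G A).card = A.card + 1 := by
  rw [← hA.numComp_eq hconn hG]
  refine h A fun v hv => hA.hasCutProperty_of_two_le hG subset_rfl ?_ hv
  rw [Finset.filter_true_of_mem fun F hF => hA.not_subset (mem_cliquesOver.1 hF).1]
  exact hA.two_le_card_cliquesOver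

theorem exists_card_eq_one_of_unmixed (hconn : G.Connected) (hG : IsGeneralizedBlockGraph G)
    (h : ∀ S, HasCutProperty G.Adj S → numComp G.Adj S = S.card + 1) {𝒜 : Finset (Finset V)}
    (h𝒜 : ∀ A ∈ 𝒜, IsJunction G A) (hF : IsMaxClique G (𝒜.sup id)) : ∃ A ∈ 𝒜, A.card = 1 := by
  by_contra! hcon
  have hcut : HasCutProperty G.Adj (𝒜.sup id) := by
    intro v hv
    obtain ⟨A, hA, hvA⟩ := Finset.mem_sup.1 hv
    have hAF : A ⊆ 𝒜.sup id := Finset.le_sup (f := id) hA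
    refine (h𝒜 A hA).hasCutProperty_of_two_le hG hAF ?_ hvA
    have h1 := card_cliquesOver_of_unmixed hconn hG h (h𝒜 A hA)
    have h2 : A.card ≠ 0 := Finset.card_ne_zero.2 (h𝒜 A hA).1
    have h3 := hcon A hA
    have h4 : (cliquesOver G A).erase (𝒜.sup id) ⊆
        (cliquesOver G A).filter fun F => ¬ F ⊆ 𝒜.sup id := by
      intro F hF'
      rw [Finset.mem_erase] at hF'
      refine Finset.mem_filter.2 ⟨hF'.2, fun hle => hF'.1 ?_⟩
      exact (mem_cliquesOver.1 hF'.2).1.eq_of_subset hF hle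
    have h5 := Finset.card_le_card h4
    rw [Finset.card_erase_of_mem (mem_cliquesOver.2 ⟨hF, hAF⟩)] at h5
    omega
  have h1 := numComp_sup_of_card hconn hG
    (fun A hA => card_cliquesOver_of_unmixed hconn hG h hA) 𝒜 h𝒜
  have h2 := h _ hcut
  -- The covered clique counts as swallowed, which leaves one component too few.
  have h3 : (cliquesIn G (𝒜.sup id)).card ≠ 0 :=
    Finset.card_ne_zero.2 ⟨_, mem_cliquesIn.2 ⟨hF, subset_rfl⟩⟩
  omega

theorem numComp_eq_of_hasCutProperty (hconn : G.Connected) (hG : IsGeneralizedBlockGraph G)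
    (ha : ∀ A, IsJunction G A → (cliquesOver G A).card = A.card + 1)
    (hb : ∀ 𝒜 : Finset (Finset V), (∀ A ∈ 𝒜, IsJunction G A) → IsMaxClique G (𝒜.sup id) →
      ∃ A ∈ 𝒜, A.card = 1) (hS : HasCutProperty G.Adj S) :
    numComp G.Adj S = S.card + 1 := by
  classical
  have hcover {v : V} (hv : v ∈ S) : ∃ A, IsJunction G A ∧ A ⊆ S ∧ v ∈ A := by
    obtain ⟨F₁, F₂, h1, h2, hne, hv1, hv2, -, -, hsub⟩ := hS.exists_cliques hv
    have hv12 := Finset.mem_inter.2 ⟨hv1, hv2⟩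
    exact ⟨F₁ ∩ F₂, ⟨⟨v, hv12⟩, F₁, F₂, h1, h2, hne, rfl⟩, hsub, hv12⟩
  have hsup {T : Finset V} (hTS : T ⊆ S) (hT : ∀ A, IsJunction G A → ∀ v ∈ A, v ∈ T → A ⊆ T) :
      (Finset.univ.filter fun A => IsJunction G A ∧ A ⊆ T).sup id = T := by
    refine le_antisymm (Finset.sup_le fun A hA => (Finset.mem_filter.1 hA).2.2) fun v hv => ?_
    obtain ⟨A, hA, -, hvA⟩ := hcover (hTS hv)
    exact Finset.mem_sup.2 ⟨A, by simpa using ⟨hA, hT A hA v hvA hv⟩, hvA⟩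
  have hJ (T : Finset V) : ∀ A ∈ Finset.univ.filter fun A => IsJunction G A ∧ A ⊆ T,
      IsJunction G A := fun A hA => (Finset.mem_filter.1 hA).2.1
  have hSsup := hsup subset_rfl fun A hA v hvA hvS => by
    obtain ⟨B, hB, hBS, hvB⟩ := hcover hvS
    exact (hA.subset_of_mem_of_mem hB hG hvA hvB).trans hBS
  have hcount := numComp_sup_of_card hconn hG ha _ (hJ S)
  rw [hSsup] at hcount
  have hnone : cliquesIn G S = ∅ := by
    refine Finset.eq_empty_of_forall_notMem fun F hF => ?_
    obtain ⟨hF, hFS⟩ := mem_cliquesIn.1 hF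
    have hFsup := hsup hFS fun A hA v hvA hvF => hA.subset_of_mem hG hF hvA hvF
    obtain ⟨A, hA, hcard⟩ := hb _ (hJ F) (by rwa [hFsup])
    obtain ⟨-, hA, hAF⟩ := Finset.mem_filter.1 hA
    obtain ⟨v, hv⟩ := hA.1
    obtain ⟨F₁, F₂, h1, h2, hne, hv1, hv2, hn1, hn2, -⟩ := hS.exists_cliques (hFS (hAF hv))
    -- A one-point junction lies in exactly two maximal cliques by `ha`, yet `F` and the two cliques
    -- leaving `S` are three.
    have hsub : {F, F₁, F₂} ⊆ cliquesOver G A := by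
      simp [Finset.insert_subset_iff, hF, h1, h2, hAF, hA.subset_of_mem hG h1 hv hv1,
        hA.subset_of_mem hG h2 hv hv2]
    have hle := Finset.card_le_card hsub
    rw [ha A hA, hcard, Finset.card_eq_three.2 ⟨F, F₁, F₂, ?_, ?_, hne, rfl⟩] at hle
    · omega
    · rintro rfl; exact hn1 hFS
    · rintro rfl; exact hn2 hFS
  simpa [hnone] using hcount

end CutSets

end GenBlock

theorem theorem3p3 {K : Type*} [Field K] {V : Type*} [Fintype V] [DecidableEq V]
    (G : SimpleGraph V) (hconn : G.Connected) (hG : GenBlock.IsGeneralizedBlockGraph G) :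
    GenBlock.IsUnmixed (GenBlock.binomialEdgeIdeal K G) ↔
      (∀ (t : ℕ) (A : Finset V), GenBlock.IsTMinimalCutSet G t A → (A.card : ℤ) = (t : ℤ) - 1) ∧
      (∀ 𝒜 : Finset (Finset V), (∀ A ∈ 𝒜, GenBlock.IsMinimalCutSet G A) →
        GenBlock.IsMaxClique G (𝒜.sup id) → ∃ A ∈ 𝒜, A.card = 1) := by
  rw [GenBlock.binomialEdgeIdeal_eq_relIdeal,
    GenBlock.isUnmixed_relIdeal_iff (fun _ _ h => h.symm) (GenBlock.numComp_empty hconn)]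
  simp only [GenBlock.isTMinimalCutSet_iff hconn hG, GenBlock.isMinimalCutSet_iff hconn hG]
  constructor
  · refine fun h => ⟨?_, fun 𝒜 => GenBlock.exists_card_eq_one_of_unmixed hconn hG h⟩
    rintro t A ⟨hA, rfl⟩
    rw [GenBlock.card_cliquesOver_of_unmixed hconn hG h hA]
    push_cast
    ring
  · rintro ⟨ha, hb⟩ S hS
    refine GenBlock.numComp_eq_of_hasCutProperty hconn hG (fun A hA => ?_) hb hS
    have := ha _ A ⟨hA, rfl⟩
    omega
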